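/- Setting. Two datasets $x,x'\in(\mathbb R^d)^n$ are neighboring if they differ in at most one entry. A randomized algorithm (Markov kernel) $M$ from $(\mathbb R^d)^n$ to a measurable space $\mathcal Y$ is $\varepsilon$-differentially private ($\varepsilon$-DP) if $\Pr[M(x)\in Y]\le e^{\varepsilon}\,\Pr[M(x')\in Y]$ for all neighboring $x,x'$ and all measurable $Y\subseteq\mathcal Y$. For probability measures $P,Q$ let $d_{TV}(P,Q)=\sup_A|P(A)-Q(A)|$, over measurable sets $A$, and let $\|\cdot\|_F$ be the Frobenius norm. Below, $d,n\ge 0$ are integers and $\varepsilon>0$ is arbitrary. **Theorem (learning in total variation).** There are absolute constants $\alpha_0\in(0,1]$ and $c>0$ such that the following holds for all $d,n$, all $\varepsilon>0$ and all $0<\alpha\le\alpha_0$. Let $M$ be an $\varepsilon$-DP mechanism which maps $(\mathbb R^d)^n$ to probability measures on $\mathbb R^d$ (not necessarily Gaussian; the space of probability measures carries the $\sigma$-algebra generated by the evaluations $Q\mapsto Q(A)$), and suppose that for every symmetric $\Sigma\in\mathbb R^{d\times d}$ with $\tfrac12 I\preceq\Sigma\preceq\tfrac32 I$, $$\Pr_{X\sim\mathcal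 N(0,\Sigma)^{\otimes n},\,M}\bigl[d_{TV}(\mathcal N(0,\Sigma),M(X))\le\alpha\bigr]\ \ge\ \tfrac23 .$$ Then $n\ge c\,\dfrac{d^2}{\alpha\varepsilon}$. (A fortiori, the same bound holds for mechanisms that are required to learn a larger class of Gaussians on $\mathbb R^d$, or to output a Gaussian.) **Lemma (estimating the covariance in Frobenius norm).** There is an absolute constant $c>0$ such that the following holds for all $d,n$, all $\varepsilon>0$ and all $0<\alpha\le1$. Let $M$ be an $\varepsilon$-DP mechanism which maps $(\mathbb R^d)^n$ to real symmetric positive semidefinite $d\times d$ matrices, and suppose that for every symmetric $\Sigma\in\mathbb R^{d\times d}$ with $\tfrac12 I\preceq\Sigma\preceq\tfrac32 I$, $$\mathbb E_{X\sim\mathcal N(0,\Sigma)^{\otimes n},\,M}\bigl[\|M(X)-\Sigma\|_F^2\bigr]\ \le\ \frac{\alpha^2}{64}.$$ Then $n\ge c\,\dfrac{d^2}{\alpha\varepsilon}$. -/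

import Mathlib

open MeasureTheory ProbabilityTheory

noncomputable section

namespace PrivateCovariance

/-- Two datasets of size `n` are neighboring if they differ in at most one entry. -/
def Neighboring {X : Type*} {n : ℕ} (x x' : Fin n → X) : Prop :=
  {i | x i ≠ x' i}.Subsingleton

/-- `(ε, δ)`-differential privacy of a randomized algorithm `M : X ^ n → Y`, given as a Markov
kernel. Pure `ε`-differential privacy is the case `δ = 0`. -/
def IsDP {X Y : Type*} [MeasurableSpace X] [MeasurableSpace Y] {n : ℕ}
    (M : Kernel (Fin n → X) Y) (ε δ : ℝ) : Prop :=
  ∀ x x' : Fin n → X, Neighboring x x' → ∀ S : Set Y, MeasurableSet S →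
    M x S ≤ ENNReal.ofReal (Real.exp ε) * M x' S + ENNReal.ofReal δ

/-- Total variation distance `sup_A |P(A) - Q(A)|`, the supremum being over measurable sets,
between two probability measures. -/
def tvDist {Ω : Type*} [MeasurableSpace Ω] (P Q : Measure Ω) : ℝ :=
  ⨆ A : {A : Set Ω // MeasurableSet A}, |P.real A.1 - Q.real A.1|

/-- The law of `n` independent samples from the Gaussian `N(0, S)` on `ℝ ^ d`. -/
def gaussianSamples (n : ℕ) {d : ℕ} (S : Matrix (Fin d) (Fin d) ℝ) :
    Measure (Fin n → EuclideanSpace ℝ (Fin d)) :=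
  Measure.pi fun _ => multivariateGaussian 0 S

/-- `(1/2) I ≼ S ≼ (3/2) I` in the Loewner order, for a real matrix `S` (which is then
symmetric). -/
def WellConditioned {d : ℕ} (S : Matrix (Fin d) (Fin d) ℝ) : Prop :=
  (S - (1 / 2 : ℝ) • (1 : Matrix (Fin d) (Fin d) ℝ)).PosSemidef ∧
    ((3 / 2 : ℝ) • (1 : Matrix (Fin d) (Fin d) ℝ) - S).PosSemidef

/-- The mechanism `M`, run on `n` independent samples from `N(0, S)`, outputs with probability
at least `2/3` (over the samples and the randomness of `M`) a probability measure within total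
variation distance `α` of `N(0, S)`, for every `S` with `(1/2) I ≼ S ≼ (3/2) I`. -/
def LearnsGaussian {n d : ℕ}
    (M : Kernel (Fin n → EuclideanSpace ℝ (Fin d))
      (ProbabilityMeasure (EuclideanSpace ℝ (Fin d)))) (α : ℝ) : Prop :=
  ∀ S : Matrix (Fin d) (Fin d) ℝ, WellConditioned S →
    2 / 3 ≤ (M ∘ₘ gaussianSamples n S)
      {Q | tvDist (multivariateGaussian 0 S) (Q : Measure (EuclideanSpace ℝ (Fin d))) ≤ α}

/-- The space of `d × d` real symmetric positive semidefinite matrices. -/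
abbrev PSDMatrix (d : ℕ) : Type := {A : Matrix (Fin d) (Fin d) ℝ // A.PosSemidef}

/-- The Borel `σ`-algebra on positive semidefinite matrices, generated by the entries. -/
instance (d : ℕ) : MeasurableSpace (PSDMatrix d) :=
  MeasurableSpace.comap (fun (A : PSDMatrix d) (i j : Fin d) => A.1 i j) MeasurableSpace.pi

/-- The squared Frobenius norm. -/
def frobeniusSq {d : ℕ} (A : Matrix (Fin d) (Fin d) ℝ) : ℝ := ∑ i, ∑ j, A i j ^ 2

/-- The mechanism `M`, run on `n` independent samples from `N(0, S)`, estimates `S` with expected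
squared Frobenius error at most `r`, for every `S` with `(1/2) I ≼ S ≼ (3/2) I`. -/
def EstimatesCovariance {n d : ℕ}
    (M : Kernel (Fin n → EuclideanSpace ℝ (Fin d)) (PSDMatrix d)) (r : ℝ) : Prop :=
  ∀ S : Matrix (Fin d) (Fin d) ℝ, WellConditioned S →
    ∫⁻ A, ENNReal.ofReal (frobeniusSq (A.1 - S)) ∂(M ∘ₘ gaussianSamples n S)
      ≤ ENNReal.ofReal r

end PrivateCovariance

end

/-!
Around the identity there are `exp (c d ^ 2)` covariance matrices at Frobenius distance `ρ` from it
and, by a binary code, at distance of order `ρ` from each other. The Gaussian with such a covariance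
has `χ²`-divergence at most `2 ρ ^ 2` from the standard Gaussian, so a sample of size `n` from it
can be coupled with a standard one so that only `O(n ρ)` entries differ on average. By group
privacy, an `ε`-private mechanism then gives the answer for each of these covariances probability at
least `exp (- O(n ρ ε))` on a standard sample. If the answers are disjoint events, their number is
at most `exp (O(n ρ ε))`, whence `d ^ 2 ≲ n ρ ε`.

That the answers are disjoint is immediate for estimation in Frobenius norm. For learning in total
variation one needs a lower bound on the distance of `N(0, S)` and `N(0, T)`: if `f` is the
quadratic form of `S - T`, then `‖S - T‖ ^ 2` is the difference of the means of `f` under the two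
Gaussians, and interpolating (Hölder) between total variation, the two `χ²`-divergences and the
fourth moment of `f` under the standard Gaussian bounds this difference by
`O(√(tv * ρ) * ‖S - T‖)`.
-/

open scoped ENNReal NNReal RealInnerProductSpace

namespace PrivateCovariance

lemma exists_maximal_pairwise {α : Type*} [Finite α] {r : α → α → Prop} [Std.Symm r] :
    ∃ C : Finset α, (C : Set α).Pairwise r ∧ ∀ a, ∃ c ∈ C, a = c ∨ ¬ r a c := by
  classical
  obtain ⟨C, hC⟩ := Set.toFinite {C : Finset α | (C : Set α).Pairwise r}
    |>.exists_maximal ⟨∅, by simp⟩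
  refine ⟨C, hC.prop, fun a ↦ ?_⟩
  by_contra! hfar
  have hinsert : ((insert a C : Finset α) : Set α).Pairwise r := by
    rw [Finset.coe_insert]
    exact hC.prop.insert_of_symm fun c hc _ ↦ (hfar c hc).2
  exact (hfar a (hC.le_of_ge hinsert (Finset.subset_insert a C) (Finset.mem_insert_self a C))).1 rfl

section Codes

variable {ι α : Type*} [Fintype ι] [DecidableEq ι] [Fintype α] [DecidableEq α]

lemma sum_pow_hammingDist (c : ι → α) (q : ℝ) :
    ∑ a : ι → α, q ^ hammingDist a c = (1 + (Fintype.card α - 1) * q) ^ Fintype.card ι := by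
  have hprod (a : ι → α) : q ^ hammingDist a c = ∏ i, if a i = c i then 1 else q := by
    simp [hammingDist, Finset.prod_ite]
  have hcoord (i : ι) : ∑ b, (if b = c i then 1 else q) = 1 + (Fintype.card α - 1) * q := by
    rw [← Finset.add_sum_erase _ _ (Finset.mem_univ (c i)), if_pos rfl,
      Finset.sum_congr rfl fun b hb ↦ if_neg (Finset.ne_of_mem_erase hb), Finset.sum_const,
      nsmul_eq_mul, Finset.cast_card_erase_of_mem (Finset.mem_univ _), Finset.card_univ]
  simp_rw [hprod]
  rw [← Fintype.piFinset_univ, ← Finset.prod_univ_sum (fun _ ↦ Finset.univ)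
    fun i b ↦ if b = c i then 1 else q]
  simp only [hcoord, Finset.prod_const, Finset.card_univ]

omit [DecidableEq ι] in
/-- Gilbert–Varshamov: the balls of radius `r` around the words of a maximal code cover the cube,
and `q ^ (hammingDist · c - r)` is at least `1` on the ball around `c`. -/
lemma exists_code_card_mul_ge {q r : ℝ} (hq : 0 < q) (hq1 : q ≤ 1) (hr : 0 ≤ r) :
    ∃ C : Finset (ι → α), (C : Set (ι → α)).Pairwise (fun a b ↦ r ≤ hammingDist a b) ∧
      (Fintype.card α : ℝ) ^ Fintype.card ι * q ^ r
        ≤ C.card * (1 + (Fintype.card α - 1) * q) ^ Fintype.card ι := by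
  classical
  have : Std.Symm fun a b : ι → α ↦ r ≤ hammingDist a b :=
    ⟨fun a b hab ↦ by rwa [hammingDist_comm b a]⟩
  obtain ⟨C, hC, hcover⟩ := exists_maximal_pairwise (r := fun a b : ι → α ↦ r ≤ hammingDist a b)
  refine ⟨C, hC, ?_⟩
  have hnear (a : ι → α) : q ^ r ≤ ∑ c ∈ C, q ^ hammingDist a c := by
    obtain ⟨c, hc, hac⟩ := hcover a
    have hdist : (hammingDist a c : ℝ) ≤ r := by
      rcases hac with rfl | hac
      · simpa using hr
      · exact (not_le.1 hac).le
    calc q ^ r ≤ q ^ (hammingDist a c : ℝ) := Real.rpow_le_rpow_of_exponent_ge hq hq1 hdist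
      _ = q ^ hammingDist a c := Real.rpow_natCast _ _
      _ ≤ ∑ c ∈ C, q ^ hammingDist a c :=
        Finset.single_le_sum (f := fun c ↦ q ^ hammingDist a c) (fun c _ ↦ by positivity) hc
  calc (Fintype.card α : ℝ) ^ Fintype.card ι * q ^ r = ∑ _a : ι → α, q ^ r := by
        simp
    _ ≤ ∑ a : ι → α, ∑ c ∈ C, q ^ hammingDist a c := Finset.sum_le_sum fun a _ ↦ hnear a
    _ = C.card * (1 + (Fintype.card α - 1) * q) ^ Fintype.card ι := by
        rw [Finset.sum_comm]
        simp only [sum_pow_hammingDist, Finset.sum_const, nsmul_eq_mul]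

variable (ι) in
omit [DecidableEq ι] in
lemma exists_binary_code_log_card_ge :
    ∃ C : Finset (ι → Bool),
      (C : Set (ι → Bool)).Pairwise (fun a b ↦ 3 / 8 * (Fintype.card ι : ℝ) ≤ hammingDist a b) ∧
      (Fintype.card ι : ℝ) / 36 ≤ Real.log C.card := by
  set m : ℝ := (Fintype.card ι : ℝ)
  obtain ⟨C, hC, hcard⟩ := exists_code_card_mul_ge (ι := ι) (α := Bool) (q := 3 / 5)
    (r := 3 / 8 * m) (by norm_num) (by norm_num) (by positivity)
  refine ⟨C, hC, ?_⟩
  have hpos : (0 : ℝ) < C.card := pos_of_mul_pos_left (hcard.trans_lt' (by positivity)) (by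
    norm_num)
  have hlog := Real.log_le_log (by positivity) hcard
  norm_num only [Fintype.card_bool, Nat.cast_ofNat] at hlog
  rw [Real.log_mul (by positivity) (by positivity), Real.log_mul (by positivity) (by positivity),
    Real.log_rpow (by norm_num), Real.log_pow, Real.log_pow] at hlog
  have hrate : 8 * (1 / 36) ≤ 8 * Real.log 2 + 3 * Real.log (3 / 5) - 8 * Real.log (8 / 5) := by
    calc (8 * (1 / 36) : ℝ) ≤ 1 - (84375 / 65536)⁻¹ := by norm_num
      _ ≤ Real.log (84375 / 65536) := Real.one_sub_inv_le_log_of_pos (by norm_num)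
      _ = Real.log (2 ^ 8 * (3 / 5) ^ 3 / (8 / 5) ^ 8) := by norm_num
      _ = _ := by
        rw [Real.log_div (by positivity) (by positivity),
          Real.log_mul (by positivity) (by positivity), Real.log_pow, Real.log_pow, Real.log_pow]
        norm_num
  have hm : 0 ≤ m := by positivity
  nlinarith [mul_le_mul_of_nonneg_left hrate hm]

end Codes

section Coupling

variable {E : Type*} [MeasurableSpace E]

lemma measurableSet_ne [MeasurableEq E] : MeasurableSet {z : E × E | z.1 ≠ z.2} :=
  (measurableSet_eq_fun measurable_fst measurable_snd).compl

/-- `γ` is a coupling of `P` and `Q`: a measure on the product with these marginals. -/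
structure IsCoupling (γ : Measure (E × E)) (P Q : Measure E) : Prop where
  map_fst : γ.map Prod.fst = P
  map_snd : γ.map Prod.snd = Q

lemma IsCoupling.isProbabilityMeasure {γ : Measure (E × E)} {P Q : Measure E}
    [IsProbabilityMeasure P] (hγ : IsCoupling γ P Q) : IsProbabilityMeasure γ := by
  rw [← Measure.isProbabilityMeasure_map_iff (f := Prod.fst) measurable_fst.aemeasurable,
    hγ.map_fst]
  infer_instance

/-- The common part `R` is put on the diagonal, and the two remainders are coupled
independently. -/
lemma exists_isCoupling_of_le [MeasurableEq E] {P Q R : Measure E} [IsProbabilityMeasure P]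
    [IsProbabilityMeasure Q] (hRP : R ≤ P) (hRQ : R ≤ Q) :
    ∃ γ, IsCoupling γ P Q ∧ γ {z | z.1 ≠ z.2} ≤ 1 - R Set.univ := by
  have : IsFiniteMeasure R := isFiniteMeasure_of_le P hRP
  set p : ℝ≥0∞ := 1 - R Set.univ
  have hp : p ≠ ∞ := (tsub_le_self.trans_lt ENNReal.one_lt_top).ne
  have hmass {ν : Measure E} [IsProbabilityMeasure ν] (hν : R ≤ ν) :
      (ν - R) Set.univ = p := by
    rw [Measure.sub_apply .univ hν, measure_univ]
  have hsmul {ν : Measure E} (hν : ν Set.univ = p) : p⁻¹ • p • ν = ν := by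
    rcases eq_or_ne p 0 with h0 | h0
    · rw [h0, Measure.measure_univ_eq_zero] at hν
      simp [hν]
    · rw [smul_smul, ENNReal.inv_mul_cancel h0 hp, one_smul]
  have hdiag : Measurable fun x : E ↦ (x, x) := by fun_prop
  refine ⟨R.map (fun x ↦ (x, x)) + p⁻¹ • (P - R).prod (Q - R), ⟨?_, ?_⟩, ?_⟩
  · rw [Measure.map_add _ _ measurable_fst, Measure.map_map measurable_fst hdiag,
      Measure.map_smul, Measure.map_fst_prod, hmass hRQ, hsmul (hmass hRP), add_comm]
    exact (congrArg _ Measure.map_id).trans (Measure.sub_add_cancel_of_le hRP)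
  · rw [Measure.map_add _ _ measurable_snd, Measure.map_map measurable_snd hdiag,
      Measure.map_smul, Measure.map_snd_prod, hmass hRP, hsmul (hmass hRQ), add_comm]
    exact (congrArg _ Measure.map_id).trans (Measure.sub_add_cancel_of_le hRQ)
  · have hzero : (R.map fun x ↦ (x, x)) {z : E × E | z.1 ≠ z.2} = 0 := by
      simp [Measure.map_apply hdiag measurableSet_ne]
    calc _ = p⁻¹ * ((P - R).prod (Q - R)) {z | z.1 ≠ z.2} := by
          rw [Measure.add_apply, hzero, zero_add, Measure.smul_apply, smul_eq_mul]
      _ ≤ p⁻¹ * ((P - R).prod (Q - R)) (Set.univ ×ˢ Set.univ) := by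
          gcongr
          simp
      _ = p⁻¹ * p * p := by
          rw [Measure.prod_prod, hmass hRP, hmass hRQ, mul_assoc]
      _ ≤ 1 * p := by
          gcongr
          exact ENNReal.inv_mul_le_one p
      _ = p := one_mul p

lemma exists_isCoupling_le_integral_abs_rnDeriv_sub_one [MeasurableEq E] {P Q : Measure E}
    [IsProbabilityMeasure P] [IsProbabilityMeasure Q] (hPQ : P ≪ Q) :
    ∃ γ, IsCoupling γ P Q ∧
      γ {z | z.1 ≠ z.2} ≤ ENNReal.ofReal (∫ x, |(P.rnDeriv Q x).toReal - 1| ∂Q) := by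
  have hl : Measurable (P.rnDeriv Q) := Measure.measurable_rnDeriv P Q
  have hRP : Q.withDensity (fun x ↦ min (P.rnDeriv Q x) 1) ≤ P := calc
    _ ≤ Q.withDensity (P.rnDeriv Q) := withDensity_mono <| .of_forall fun _ ↦ min_le_left _ _
    _ = P := Measure.withDensity_rnDeriv_eq P Q hPQ
  have hRQ : Q.withDensity (fun x ↦ min (P.rnDeriv Q x) 1) ≤ Q := calc
    _ ≤ Q.withDensity 1 := withDensity_mono <| .of_forall fun _ ↦ min_le_right _ _
    _ = Q := withDensity_one
  obtain ⟨γ, hγ, hoff⟩ := exists_isCoupling_of_le hRP hRQ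
  refine ⟨γ, hγ, hoff.trans ?_⟩
  have hint : Integrable (fun x ↦ (P.rnDeriv Q x).toReal - 1) Q :=
    Measure.integrable_toReal_rnDeriv.sub (integrable_const 1)
  rw [withDensity_apply _ .univ, Measure.restrict_univ,
    ofReal_integral_eq_lintegral_ofReal hint.abs (.of_forall fun _ ↦ abs_nonneg _),
    tsub_le_iff_right, ← lintegral_add_right _ (hl.min measurable_const)]
  calc (1 : ℝ≥0∞) = ∫⁻ _, 1 ∂Q := by simp
    _ ≤ _ := lintegral_mono_ae ?_
  filter_upwards [P.rnDeriv_ne_top Q] with x hx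
  rw [← ENNReal.ofReal_toReal hx, ← ENNReal.ofReal_one, ← ENNReal.ofReal_min,
    ← ENNReal.ofReal_add (abs_nonneg _) (by positivity),
    ENNReal.toReal_ofReal ENNReal.toReal_nonneg]
  refine ENNReal.ofReal_le_ofReal ?_
  grind

end Coupling

section CauchySchwarz

variable {E : Type*} [MeasurableSpace E] {μ : Measure E} {f g h : E → ℝ}

lemma sq_integral_mul_le (hf : MemLp f 2 μ) (hg : MemLp g 2 μ) :
    (∫ x, f x * g x ∂μ) ^ 2 ≤ (∫ x, f x ^ 2 ∂μ) * ∫ x, g x ^ 2 ∂μ := by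
  have hquad (t : ℝ) : 0 ≤ (∫ x, f x ^ 2 ∂μ) * (t * t) + (2 * ∫ x, f x * g x ∂μ) * t
      + ∫ x, g x ^ 2 ∂μ := calc
    0 ≤ ∫ x, (t * f x + g x) ^ 2 ∂μ := integral_nonneg fun _ ↦ sq_nonneg _
    _ = ∫ x, (t * t) * f x ^ 2 + (2 * t) * (f x * g x) + g x ^ 2 ∂μ := by
      congr with x
      ring
    _ = _ := by
      have hff : Integrable (fun x ↦ f x ^ 2) μ := hf.integrable_sq
      have hfg : Integrable (fun x ↦ f x * g x) μ := hf.integrable_mul hg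
      rw [integral_add (by fun_prop) hg.integrable_sq, integral_add (by fun_prop) (by fun_prop),
        integral_const_mul, integral_const_mul]
      ring
  have := discrim_le_zero hquad
  rw [discrim] at this
  linarith

lemma memLp_sq {p : ℝ≥0∞} (hf : MemLp f (2 * p) μ) : MemLp (fun x ↦ f x ^ 2) p μ := by
  simpa [mul_comm (2 : ℝ≥0∞), ENNReal.mul_div_cancel_right] using hf.norm_rpow_div 2

lemma integrable_pow_of_memLp [IsFiniteMeasure μ] {p k : ℕ} (hf : MemLp f p μ) (hk : k ≤ p) :
    Integrable (fun x ↦ f x ^ k) μ := by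
  have hfm : AEStronglyMeasurable f μ := hf.1
  rw [← integrable_norm_iff (by fun_prop)]
  simpa using (hf.mono_exponent (p := k) (by exact_mod_cast hk)).integrable_norm_pow'

lemma memLp_two_sqrt_abs (hh : Integrable h μ) : MemLp (fun x ↦ √|h x|) 2 μ := by
  have hhm : AEMeasurable h μ := hh.1.aemeasurable
  rw [memLp_two_iff_integrable_sq (by fun_prop)]
  simpa using hh.abs

/-- Hölder's inequality for `h f = √|h| · (±√|h| f)`, followed by one for `|h| f ^ 2`. -/
lemma pow_four_integral_mul_le (hh1 : Integrable h μ) (hh2 : MemLp h 2 μ) (hf : MemLp f 4 μ) :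
    (∫ x, h x * f x ∂μ) ^ 4 ≤ (∫ x, |h x| ∂μ) ^ 2 * (∫ x, h x ^ 2 ∂μ) * ∫ x, f x ^ 4 ∂μ := by
  have hf2 : MemLp (fun x ↦ f x ^ 2) 2 μ := memLp_sq (by norm_num; exact hf)
  have hhf : Integrable (fun x ↦ |h x| * f x ^ 2) μ := hh2.abs.integrable_mul hf2
  have hsqrt : MemLp (fun x ↦ √|h x| * |f x|) 2 μ := by
    rw [memLp_two_iff_integrable_sq]
    · simpa [mul_pow] using hhf
    · exact (memLp_two_sqrt_abs hh1).1.mul hf.abs.1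
  have hfirst : (∫ x, h x * f x ∂μ) ^ 2 ≤ (∫ x, |h x| ∂μ) * ∫ x, |h x| * f x ^ 2 ∂μ := calc
    (∫ x, h x * f x ∂μ) ^ 2 ≤ (∫ x, |h x * f x| ∂μ) ^ 2 :=
      sq_le_sq' (neg_le_of_abs_le abs_integral_le_integral_abs)
        (le_of_abs_le abs_integral_le_integral_abs)
    _ = (∫ x, √|h x| * (√|h x| * |f x|) ∂μ) ^ 2 := by
      simp_rw [← mul_assoc, Real.mul_self_sqrt (abs_nonneg _), abs_mul]
    _ ≤ (∫ x, √|h x| ^ 2 ∂μ) * ∫ x, (√|h x| * |f x|) ^ 2 ∂μ :=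
      sq_integral_mul_le (memLp_two_sqrt_abs hh1) hsqrt
    _ = _ := by simp_rw [mul_pow, Real.sq_sqrt (abs_nonneg _), sq_abs]
  have hsecond : (∫ x, |h x| * f x ^ 2 ∂μ) ^ 2 ≤ (∫ x, h x ^ 2 ∂μ) * ∫ x, f x ^ 4 ∂μ := by
    simpa [← pow_mul] using sq_integral_mul_le hh2.abs hf2
  calc (∫ x, h x * f x ∂μ) ^ 4 = ((∫ x, h x * f x ∂μ) ^ 2) ^ 2 := by ring
    _ ≤ ((∫ x, |h x| ∂μ) * ∫ x, |h x| * f x ^ 2 ∂μ) ^ 2 := by gcongr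
    _ = (∫ x, |h x| ∂μ) ^ 2 * (∫ x, |h x| * f x ^ 2 ∂μ) ^ 2 := by ring
    _ ≤ (∫ x, |h x| ∂μ) ^ 2 * ((∫ x, h x ^ 2 ∂μ) * ∫ x, f x ^ 4 ∂μ) := by gcongr
    _ = _ := by ring

end CauchySchwarz

section Divergences

variable {E : Type*} [MeasurableSpace E]

/-- The `χ²`-divergence `∫ (dP/dQ - 1) ^ 2 dQ`, used for `P ≪ Q` with `dP/dQ` in `L²(Q)`. It has
the junk value `0` when `dP/dQ` is not square integrable. -/
noncomputable def chiSqDiv (P Q : Measure E) : ℝ := ∫ x, ((P.rnDeriv Q x).toReal - 1) ^ 2 ∂Q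

variable {P P' Q : Measure E} [IsProbabilityMeasure P] [IsProbabilityMeasure P']
  [IsProbabilityMeasure Q]

lemma chiSqDiv_eq_integral_sq_sub_one (hPQ : P ≪ Q)
    (hP : MemLp (fun x ↦ (P.rnDeriv Q x).toReal) 2 Q) :
    chiSqDiv P Q = ∫ x, (P.rnDeriv Q x).toReal ^ 2 ∂Q - 1 := by
  have hsq := hP.integrable_sq
  have : Integrable (fun x ↦ (P.rnDeriv Q x).toReal) Q := Measure.integrable_toReal_rnDeriv
  simp only [chiSqDiv, sub_sq, one_pow, mul_one]
  rw [integral_add (by fun_prop) (by fun_prop), integral_sub (by fun_prop) (by fun_prop),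
    integral_const_mul, Measure.integral_toReal_rnDeriv hPQ, integral_const]
  simp only [probReal_univ, one_smul]
  ring

lemma exists_isCoupling_le_sqrt_chiSqDiv [MeasurableEq E] (hPQ : P ≪ Q)
    (hP : MemLp (fun x ↦ (P.rnDeriv Q x).toReal) 2 Q) :
    ∃ γ, IsCoupling γ P Q ∧ γ {z | z.1 ≠ z.2} ≤ ENNReal.ofReal √(chiSqDiv P Q) := by
  obtain ⟨γ, hγ, hoff⟩ := exists_isCoupling_le_integral_abs_rnDeriv_sub_one hPQ
  refine ⟨γ, hγ, hoff.trans <| ENNReal.ofReal_le_ofReal <| Real.le_sqrt_of_sq_le ?_⟩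
  simpa [chiSqDiv] using sq_integral_mul_le (hP.sub (memLp_const 1)).abs (memLp_const (1 : ℝ))

lemma abs_real_sub_real_le_tvDist {A : Set E} (hA : MeasurableSet A) :
    |P.real A - P'.real A| ≤ tvDist P P' := by
  refine le_ciSup (f := fun B : {B : Set E // MeasurableSet B} ↦ |P.real B.1 - P'.real B.1|)
    ⟨1, ?_⟩ ⟨A, hA⟩
  rintro - ⟨B, rfl⟩
  exact abs_sub_le_of_nonneg_of_le measureReal_nonneg measureReal_le_one measureReal_nonneg
    measureReal_le_one

lemma integral_abs_rnDeriv_sub_rnDeriv_le_two_mul_tvDist (hP : P ≪ Q) (hP' : P' ≪ Q) :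
    ∫ x, |(P.rnDeriv Q x).toReal - (P'.rnDeriv Q x).toReal| ∂Q ≤ 2 * tvDist P P' := by
  set h : E → ℝ := fun x ↦ (P.rnDeriv Q x).toReal - (P'.rnDeriv Q x).toReal
  have hh : Integrable h Q :=
    Measure.integrable_toReal_rnDeriv.sub Measure.integrable_toReal_rnDeriv
  set A : Set E := {x | 0 ≤ h x}
  have hA : MeasurableSet A := measurableSet_le measurable_const (by fun_prop)
  have hset (B : Set E) : ∫ x in B, h x ∂Q = P.real B - P'.real B := by
    rw [integral_sub Measure.integrable_toReal_rnDeriv.integrableOn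
      Measure.integrable_toReal_rnDeriv.integrableOn, Measure.setIntegral_toReal_rnDeriv hP,
      Measure.setIntegral_toReal_rnDeriv hP']
  calc ∫ x, |h x| ∂Q = (∫ x in A, |h x| ∂Q) + ∫ x in Aᶜ, |h x| ∂Q :=
        (integral_add_compl hA hh.abs).symm
    _ = (∫ x in A, h x ∂Q) + ∫ x in Aᶜ, -h x ∂Q := by
        congr 1
        · exact setIntegral_congr_fun hA fun x hx ↦ abs_of_nonneg hx
        · exact setIntegral_congr_fun hA.compl fun x hx ↦ abs_of_neg (not_le.1 hx)
    _ = 2 * (P.real A - P'.real A) := by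
        rw [integral_neg, hset, hset, probReal_compl_eq_one_sub hA, probReal_compl_eq_one_sub hA]
        ring
    _ ≤ 2 * tvDist P P' := by
        gcongr
        exact le_of_abs_le (abs_real_sub_real_le_tvDist hA)

omit [IsProbabilityMeasure P] [IsProbabilityMeasure P'] in
lemma integral_sq_rnDeriv_sub_rnDeriv_le
    (hP : MemLp (fun x ↦ (P.rnDeriv Q x).toReal) 2 Q)
    (hP' : MemLp (fun x ↦ (P'.rnDeriv Q x).toReal) 2 Q) :
    ∫ x, ((P.rnDeriv Q x).toReal - (P'.rnDeriv Q x).toReal) ^ 2 ∂Q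
      ≤ 2 * (chiSqDiv P Q + chiSqDiv P' Q) := by
  have hsq : Integrable (fun x ↦ ((P.rnDeriv Q x).toReal - 1) ^ 2) Q :=
    (hP.sub (memLp_const 1)).integrable_sq
  have hsq' : Integrable (fun x ↦ ((P'.rnDeriv Q x).toReal - 1) ^ 2) Q :=
    (hP'.sub (memLp_const 1)).integrable_sq
  rw [chiSqDiv, chiSqDiv, ← integral_add hsq hsq', ← integral_const_mul]
  refine integral_mono (hP.sub hP').integrable_sq ((hsq.add hsq').const_mul 2) fun x ↦ ?_
  beta_reduce
  nlinarith [sq_nonneg (((P.rnDeriv Q x).toReal - 1) + ((P'.rnDeriv Q x).toReal - 1))]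

/-- Measures that a statistic `f` tells apart are far in total variation, provided they are close
to a common reference measure. -/
lemma pow_four_integral_sub_integral_le_tvDist {f : E → ℝ} (hPQ : P ≪ Q) (hP'Q : P' ≪ Q)
    (hP : MemLp (fun x ↦ (P.rnDeriv Q x).toReal) 2 Q)
    (hP' : MemLp (fun x ↦ (P'.rnDeriv Q x).toReal) 2 Q) (hf : MemLp f 4 Q) :
    (∫ x, f x ∂P - ∫ x, f x ∂P') ^ 4
      ≤ (2 * tvDist P P') ^ 2 * (2 * (chiSqDiv P Q + chiSqDiv P' Q)) * ∫ x, f x ^ 4 ∂Q := by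
  have hf2 : MemLp f 2 Q := hf.mono_exponent (by norm_num)
  have hPf : Integrable (fun x ↦ (P.rnDeriv Q x).toReal * f x) Q := hP.integrable_mul hf2
  have hP'f : Integrable (fun x ↦ (P'.rnDeriv Q x).toReal * f x) Q := hP'.integrable_mul hf2
  have hdiff : ∫ x, f x ∂P - ∫ x, f x ∂P' =
      ∫ x, ((P.rnDeriv Q x).toReal - (P'.rnDeriv Q x).toReal) * f x ∂Q := by
    simp only [sub_mul]
    rw [integral_sub hPf hP'f, integral_toReal_rnDeriv_mul hPQ, integral_toReal_rnDeriv_mul hP'Q]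
  have hh : MemLp (fun x ↦ (P.rnDeriv Q x).toReal - (P'.rnDeriv Q x).toReal) 2 Q := hP.sub hP'
  calc _ ≤ (∫ x, |(P.rnDeriv Q x).toReal - (P'.rnDeriv Q x).toReal| ∂Q) ^ 2
        * (∫ x, ((P.rnDeriv Q x).toReal - (P'.rnDeriv Q x).toReal) ^ 2 ∂Q) * ∫ x, f x ^ 4 ∂Q := by
        rw [hdiff]
        exact pow_four_integral_mul_le (hh.integrable (by norm_num)) hh hf
    _ ≤ _ := by
        gcongr
        · exact integral_abs_rnDeriv_sub_rnDeriv_le_two_mul_tvDist hPQ hP'Q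
        · exact integral_sq_rnDeriv_sub_rnDeriv_le hP hP'

end Divergences

section ProductCoupling

variable {ι X : Type*} [Fintype ι] [MeasurableSpace X]

lemma IsCoupling.pi_eq_map {γ : Measure (X × X)} {P Q : Measure X} [IsProbabilityMeasure P]
    [IsProbabilityMeasure Q] (hγ : IsCoupling γ P Q) :
    (Measure.pi fun _ : ι ↦ P) = (Measure.pi fun _ : ι ↦ γ).map (fun z i ↦ (z i).1) ∧
      (Measure.pi fun _ : ι ↦ Q) = (Measure.pi fun _ : ι ↦ γ).map (fun z i ↦ (z i).2) := by
  have := hγ.isProbabilityMeasure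
  have : IsProbabilityMeasure (γ.map Prod.fst) := hγ.map_fst ▸ ‹IsProbabilityMeasure P›
  have : IsProbabilityMeasure (γ.map Prod.snd) := hγ.map_snd ▸ ‹IsProbabilityMeasure Q›
  rw [Measure.pi_map_pi fun _ ↦ by fun_prop, Measure.pi_map_pi fun _ ↦ by fun_prop, hγ.map_fst,
    hγ.map_snd]
  exact ⟨rfl, rfl⟩

omit [MeasurableSpace X] in
lemma natCast_hammingDist_eq_sum_indicator [DecidableEq X] (z : ι → X × X) :
    (hammingDist (fun i ↦ (z i).1) (fun i ↦ (z i).2) : ℝ≥0∞)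
      = ∑ i, {w : X × X | w.1 ≠ w.2}.indicator 1 (z i) := by
  simp [hammingDist, Set.indicator_apply, Finset.sum_ite]

variable [MeasurableEq X]

lemma measurable_hammingDist [DecidableEq X] : Measurable fun z : ι → X × X ↦
    (hammingDist (fun i ↦ (z i).1) (fun i ↦ (z i).2) : ℝ≥0∞) := by
  simp only [natCast_hammingDist_eq_sum_indicator]
  exact Finset.measurable_sum _ fun i _ ↦
    (measurable_one.indicator measurableSet_ne).comp (measurable_pi_apply i)

lemma lintegral_hammingDist [DecidableEq X] (γ : Measure (X × X)) [IsProbabilityMeasure γ] :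
    ∫⁻ z, (hammingDist (fun i ↦ (z i).1) (fun i ↦ (z i).2) : ℝ≥0∞) ∂(Measure.pi fun _ : ι ↦ γ)
      = Fintype.card ι * γ {w | w.1 ≠ w.2} := by
  have hind : Measurable ({w : X × X | w.1 ≠ w.2}.indicator (1 : X × X → ℝ≥0∞)) :=
    measurable_one.indicator measurableSet_ne
  simp only [natCast_hammingDist_eq_sum_indicator]
  rw [lintegral_finsetSum _ fun i _ ↦ by exact hind.comp (measurable_pi_apply i)]
  have hcoord (i : ι) : ∫⁻ z, {w : X × X | w.1 ≠ w.2}.indicator 1 (z i)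
      ∂(Measure.pi fun _ : ι ↦ γ) = γ {w | w.1 ≠ w.2} := by
    rw [(measurePreserving_eval (fun _ : ι ↦ γ) i).lintegral_comp hind,
      lintegral_indicator_one measurableSet_ne]
  simp [hcoord]

end ProductCoupling

section Privacy

variable {X Y : Type*} [MeasurableSpace X] [MeasurableSpace Y] {n : ℕ}
  {M : Kernel (Fin n → X) Y} {ε : ℝ}

/-- Change the entries in which `x` and `x'` differ one at a time. -/
lemma IsDP.apply_le_exp_hammingDist_mul [DecidableEq X] (hM : IsDP M ε 0) {S : Set Y}
    (hS : MeasurableSet S) (x x' : Fin n → X) :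
    M x S ≤ ENNReal.ofReal (Real.exp (ε * hammingDist x x')) * M x' S := by
  have hpiecewise (T : Finset (Fin n)) :
      M x S ≤ ENNReal.ofReal (Real.exp (ε * T.card)) * M (T.piecewise x' x) S := by
    induction T using Finset.induction_on with
    | empty => simp
    | insert i T hi ih =>
      have hneighbor : Neighboring (T.piecewise x' x) ((insert i T).piecewise x' x) := by
        rw [Finset.piecewise_insert]
        refine Set.subsingleton_singleton (a := i).anti fun j hj ↦ ?_
        by_contra hji
        exact hj (Function.update_of_ne hji _ _).symm
      calc M x S ≤ ENNReal.ofReal (Real.exp (ε * T.card)) * M (T.piecewise x' x) S := ih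
        _ ≤ ENNReal.ofReal (Real.exp (ε * T.card)) *
            (ENNReal.ofReal (Real.exp ε) * M ((insert i T).piecewise x' x) S) := by
          gcongr
          simpa using hM _ _ hneighbor S hS
        _ = _ := by
          rw [← mul_assoc, ← ENNReal.ofReal_mul (by positivity), ← Real.exp_add,
            Finset.card_insert_of_notMem hi]
          push_cast
          ring_nf
  have hx' : ({i | x i ≠ x' i} : Finset (Fin n)).piecewise x' x = x' := by
    ext i
    by_cases h : x i = x' i <;> simp [Finset.piecewise, h]
  simpa only [hx', hammingDist] using hpiecewise {i | x i ≠ x' i}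

lemma IsDP.comp_pi_le [MeasurableEq X] [DecidableEq X] [IsMarkovKernel M] (hM : IsDP M ε 0)
    (hε : 0 ≤ ε) {S : Set Y} (hS : MeasurableSet S) {P Q : Measure X} [IsProbabilityMeasure P]
    [IsProbabilityMeasure Q] {γ : Measure (X × X)} (hγ : IsCoupling γ P Q) (k : ℝ) :
    (M ∘ₘ Measure.pi fun _ : Fin n ↦ P) S ≤
      ENNReal.ofReal (Real.exp (ε * k)) * (M ∘ₘ Measure.pi fun _ : Fin n ↦ Q) S +
        (Measure.pi fun _ : Fin n ↦ γ) {z | ENNReal.ofReal k ≤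
          (hammingDist (fun i ↦ (z i).1) (fun i ↦ (z i).2) : ℝ≥0∞)} := by
  set far : Set (Fin n → X × X) := {z | ENNReal.ofReal k ≤
    (hammingDist (fun i ↦ (z i).1) (fun i ↦ (z i).2) : ℝ≥0∞)}
  have hfar : MeasurableSet far := measurableSet_le measurable_const measurable_hammingDist
  have hMS : Measurable fun x ↦ M x S := M.measurable_coe hS
  have hMS' : Measurable fun z : Fin n → X × X ↦ M (fun i ↦ (z i).2) S :=
    hMS.comp (by fun_prop)
  have hpoint (z : Fin n → X × X) : M (fun i ↦ (z i).1) S ≤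
      ENNReal.ofReal (Real.exp (ε * k)) * M (fun i ↦ (z i).2) S + far.indicator 1 z := by
    by_cases hz : z ∈ far
    · rw [Set.indicator_of_mem hz]
      exact prob_le_one.trans le_add_self
    · refine (hM.apply_le_exp_hammingDist_mul hS _ fun i ↦ (z i).2).trans
        (le_trans ?_ le_self_add)
      gcongr
      have hlt : (hammingDist (fun i ↦ (z i).1) (fun i ↦ (z i).2) : ℝ≥0∞) < ENNReal.ofReal k :=
        lt_of_not_ge hz
      rw [← ENNReal.ofReal_natCast] at hlt
      exact (ENNReal.ofReal_lt_ofReal_iff'.1 hlt).1.le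
  rw [Measure.bind_apply hS M.aemeasurable, Measure.bind_apply hS M.aemeasurable,
    hγ.pi_eq_map.1, hγ.pi_eq_map.2, lintegral_map hMS (by fun_prop),
    lintegral_map hMS (by fun_prop), ← lintegral_const_mul _ hMS',
    ← lintegral_indicator_one hfar, ← lintegral_add_right _ (measurable_one.indicator hfar)]
  exact lintegral_mono hpoint

lemma IsDP.real_comp_pi_le [MeasurableEq X] [IsMarkovKernel M] (hM : IsDP M ε 0) (hε : 0 ≤ ε)
    {S : Set Y} (hS : MeasurableSet S) {P Q : Measure X} [IsProbabilityMeasure P]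
    [IsProbabilityMeasure Q] {γ : Measure (X × X)} (hγ : IsCoupling γ P Q) {p k : ℝ}
    (hp : 0 ≤ p) (hγp : γ {z | z.1 ≠ z.2} ≤ ENNReal.ofReal p) (hk : 0 < k) :
    (M ∘ₘ Measure.pi fun _ : Fin n ↦ P).real S ≤
      Real.exp (ε * k) * (M ∘ₘ Measure.pi fun _ : Fin n ↦ Q).real S + n * p / k := by
  classical
  have := hγ.isProbabilityMeasure
  have hmarkov : (Measure.pi fun _ : Fin n ↦ γ) {z | ENNReal.ofReal k ≤
      (hammingDist (fun i ↦ (z i).1) (fun i ↦ (z i).2) : ℝ≥0∞)} ≤ ENNReal.ofReal (n * p / k) := by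
    refine (meas_ge_le_lintegral_div measurable_hammingDist.aemeasurable (by simpa using hk)
      (by simp)).trans ?_
    rw [lintegral_hammingDist, Fintype.card_fin, ENNReal.ofReal_div_of_pos hk,
      ENNReal.ofReal_mul (by positivity), ENNReal.ofReal_natCast]
    gcongr
  have hle := ENNReal.toReal_mono (by finiteness)
    ((hM.comp_pi_le hε hS hγ k).trans (add_le_add_right hmarkov _))
  rwa [ENNReal.toReal_add (by finiteness) (by finiteness), ENNReal.toReal_mul,
    ENNReal.toReal_ofReal (by positivity), ENNReal.toReal_ofReal (by positivity)] at hle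

lemma exists_real_le_inv_card {κ Ω : Type*} [MeasurableSpace Ω] {μ : Measure Ω}
    [IsProbabilityMeasure μ] {C : Finset κ} (hC : C.Nonempty) {S : κ → Set Ω}
    (hS : ∀ a ∈ C, MeasurableSet (S a)) (hdisj : (C : Set κ).PairwiseDisjoint S) :
    ∃ a ∈ C, μ.real (S a) ≤ (C.card : ℝ)⁻¹ := by
  refine Finset.exists_le_of_sum_le hC ?_
  rw [← measureReal_biUnion_finset hdisj hS, Finset.sum_const, nsmul_eq_mul,
    mul_inv_cancel₀ (by simpa using hC.ne_empty)]
  exact measureReal_le_one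

section Packing

variable [MeasurableEq X] [IsMarkovKernel M] {κ : Type*} {C : Finset κ} {P : κ → Measure X}
  {Q : Measure X} {S : κ → Set Y} {p : ℝ} [∀ a, IsProbabilityMeasure (P a)]
  [IsProbabilityMeasure Q]

lemma IsDP.log_card_lt (hM : IsDP M ε 0) (hε : 0 ≤ ε) (hS : ∀ a ∈ C, MeasurableSet (S a))
    (hdisj : (C : Set κ).PairwiseDisjoint S) (hp : 0 ≤ p)
    (hcoupling : ∀ a ∈ C, ∃ γ, IsCoupling γ (P a) Q ∧ γ {z | z.1 ≠ z.2} ≤ ENNReal.ofReal p)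
    (hsuccess : ∀ a ∈ C, 2 / 3 ≤ (M ∘ₘ Measure.pi fun _ : Fin n ↦ P a).real (S a))
    (hC : 2 ≤ C.card) {k : ℝ} (hk : 0 < k) (hnk : 24 * (n * p) ≤ k) :
    Real.log C.card < 4 * (ε * k) := by
  have hN : (2 : ℝ) ≤ C.card := by exact_mod_cast hC
  obtain ⟨a, ha, hfew⟩ := exists_real_le_inv_card (μ := M ∘ₘ Measure.pi fun _ : Fin n ↦ Q)
    (Finset.card_pos.1 (by lia)) hS hdisj
  obtain ⟨γ, hγ, hγp⟩ := hcoupling a ha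
  have hfail : n * p / k ≤ 1 / 24 := by
    rw [div_le_iff₀ hk]
    linarith
  have hexp : (C.card : ℝ) * (5 / 8) ≤ Real.exp (ε * k) := by
    rw [← le_div_iff₀' (by positivity)]
    have := hM.real_comp_pi_le hε (hS a ha) hγ hp hγp hk
    have := hsuccess a ha
    have : Real.exp (ε * k) * (M ∘ₘ Measure.pi fun _ : Fin n ↦ Q).real (S a) ≤
      Real.exp (ε * k) * (C.card : ℝ)⁻¹ := by gcongr
    rw [div_eq_mul_inv (Real.exp _)]
    linarith
  have hpow : (C.card : ℝ) < (C.card * (5 / 8)) ^ 4 := by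
    have : (2 : ℝ) ^ 3 ≤ (C.card : ℝ) ^ 3 := by gcongr
    nlinarith
  calc Real.log C.card < Real.log ((C.card * (5 / 8)) ^ 4) := Real.log_lt_log (by positivity) hpow
    _ ≤ Real.log (Real.exp (ε * k) ^ 4) := Real.log_le_log (by positivity) (by gcongr)
    _ = 4 * (ε * k) := by rw [Real.log_pow, Real.log_exp, Nat.cast_ofNat]

lemma IsDP.log_card_le (hM : IsDP M ε 0) (hε : 0 < ε) (hS : ∀ a ∈ C, MeasurableSet (S a))
    (hdisj : (C : Set κ).PairwiseDisjoint S) (hp : 0 ≤ p)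
    (hcoupling : ∀ a ∈ C, ∃ γ, IsCoupling γ (P a) Q ∧ γ {z | z.1 ≠ z.2} ≤ ENNReal.ofReal p)
    (hsuccess : ∀ a ∈ C, 2 / 3 ≤ (M ∘ₘ Measure.pi fun _ : Fin n ↦ P a).real (S a)) :
    Real.log C.card ≤ 96 * (n * p * ε) := by
  by_contra! hlt
  have hlog : 0 < Real.log C.card := hlt.trans_le' (by positivity)
  have hC : 2 ≤ C.card := by
    by_contra! hsmall
    interval_cases C.card <;> simp at hlog
  refine (hM.log_card_lt hε.le hS hdisj hp hcoupling hsuccess hC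
    (k := Real.log C.card / (4 * ε)) (by positivity) ?_).ne (by field_simp)
  rw [le_div_iff₀ (by positivity)]
  linarith

end Packing

end Privacy

section GaussianReal

lemma integrable_pow_gaussianReal (μ : ℝ) (v : ℝ≥0) (k : ℕ) :
    Integrable (fun z ↦ z ^ k) (gaussianReal μ v) :=
  integrable_pow_of_memLp (memLp_id_gaussianReal k) le_rfl

lemma integral_pow_two_mul_gaussianReal (k : ℕ) :
    ∫ z, z ^ (2 * k) ∂gaussianReal 0 1 = (2 * k - 1).doubleFactorial := by
  have heven (z : ℝ) : gaussianPDFReal 0 1 z • z ^ (2 * k)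
      = (√(2 * Real.pi))⁻¹ * (|z| ^ (2 * k : ℝ) * Real.exp (-(1 / 2) * |z| ^ (2 : ℝ))) := by
    rw [gaussianPDFReal, ← Nat.cast_ofNat, ← Nat.cast_mul, Real.rpow_natCast, Real.rpow_natCast,
      sq_abs, (even_two_mul k).pow_abs]
    simp only [Nat.cast_ofNat, NNReal.coe_one, mul_one, sub_zero, smul_eq_mul]
    ring_nf
  rw [integral_gaussianReal_eq_integral_smul one_ne_zero]
  simp only [heven]
  rw [integral_const_mul, integral_comp_abs (f := fun z ↦ z ^ (2 * k : ℝ) *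
    Real.exp (-(1 / 2) * z ^ (2 : ℝ))), integral_rpow_mul_exp_neg_mul_rpow (by norm_num)
    (by linarith [k.cast_nonneg (α := ℝ)]) (by norm_num),
    show (2 * k + 1 : ℝ) / 2 = k + 1 / 2 by ring, Real.Gamma_nat_add_half,
    neg_div, show (2 * k + 1 : ℝ) / 2 = k + 1 / 2 by ring, Real.rpow_neg (by norm_num),
    Real.rpow_add (by norm_num), Real.rpow_natCast, ← Real.sqrt_eq_rpow,
    Real.sqrt_mul (by norm_num), Real.sqrt_div (by norm_num)]
  field_simp
  simp

lemma integrable_exp_mul_sq_gaussianReal {s : ℝ} (hs : s < 1 / 2) :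
    Integrable (fun z ↦ Real.exp (s * z ^ 2)) (gaussianReal 0 1) ∧
      ∫ z, Real.exp (s * z ^ 2) ∂gaussianReal 0 1 = (√(1 - 2 * s))⁻¹ := by
  have hpdf (z : ℝ) : gaussianPDFReal 0 1 z • Real.exp (s * z ^ 2) =
      (√(2 * Real.pi))⁻¹ * Real.exp (-(1 / 2 - s) * z ^ 2) := by
    rw [gaussianPDFReal, smul_eq_mul, mul_assoc, ← Real.exp_add, NNReal.coe_one]
    ring_nf
  constructor
  · rw [gaussianReal_of_var_ne_zero _ one_ne_zero, integrable_withDensity_iff_integrable_smul'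
      (measurable_gaussianPDF 0 1) (by simp [gaussianPDF_lt_top])]
    simp only [toReal_gaussianPDF, hpdf]
    exact (integrable_exp_neg_mul_sq (by linarith)).const_mul _
  · rw [integral_gaussianReal_eq_integral_smul one_ne_zero]
    simp only [hpdf]
    rw [integral_const_mul, integral_gaussian, ← Real.sqrt_inv, ← Real.sqrt_inv,
      ← Real.sqrt_mul (by positivity)]
    congr 1
    have : 1 / 2 - s ≠ 0 := by linarith
    have : 1 - 2 * s ≠ 0 := by linarith
    field_simp

/-- The density of `N(0, v)` with respect to `N(0, 1)`. -/
noncomputable def gaussianRatio (v : ℝ≥0) (z : ℝ) : ℝ :=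
  (√v)⁻¹ * Real.exp ((1 - (v : ℝ)⁻¹) / 2 * z ^ 2)

lemma gaussianRatio_nonneg (v : ℝ≥0) (z : ℝ) : 0 ≤ gaussianRatio v z := by
  unfold gaussianRatio
  positivity

@[fun_prop]
lemma measurable_gaussianRatio (v : ℝ≥0) : Measurable (gaussianRatio v) := by
  unfold gaussianRatio
  fun_prop

lemma gaussianReal_eq_withDensity_gaussianRatio {v : ℝ≥0} (hv : v ≠ 0) :
    gaussianReal 0 v =
      (gaussianReal 0 1).withDensity fun z ↦ ENNReal.ofReal (gaussianRatio v z) := by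
  rw [gaussianReal_of_var_ne_zero _ hv, gaussianReal_of_var_ne_zero _ one_ne_zero,
    ← withDensity_mul _ (measurable_gaussianPDF 0 1) (measurable_gaussianRatio v).ennreal_ofReal]
  congr with z
  rw [Pi.mul_apply, gaussianPDF, gaussianPDF, ← ENNReal.ofReal_mul (gaussianPDFReal_nonneg _ _ _)]
  congr 1
  have : (0 : ℝ) < v := by positivity
  simp only [gaussianPDFReal, gaussianRatio, NNReal.coe_one, mul_one, sub_zero]
  rw [Real.sqrt_mul (by positivity), mul_inv, mul_mul_mul_comm, ← Real.exp_add]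
  congr 2
  field_simp
  ring

lemma integral_gaussianRatio_sq {v : ℝ≥0} (hv : v ≠ 0) (hv2 : v < 2) :
    Integrable (fun z ↦ gaussianRatio v z ^ 2) (gaussianReal 0 1) ∧
      ∫ z, gaussianRatio v z ^ 2 ∂gaussianReal 0 1 = (√(1 - ((v : ℝ) - 1) ^ 2))⁻¹ := by
  have hv' : (0 : ℝ) < v := by positivity
  have hsq (z : ℝ) : gaussianRatio v z ^ 2 = (v : ℝ)⁻¹ * Real.exp ((1 - (v : ℝ)⁻¹) * z ^ 2) := by
    rw [gaussianRatio, mul_pow, inv_pow, Real.sq_sqrt hv'.le, ← Real.exp_nat_mul]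
    congr 2
    push_cast
    ring
  have hs : 1 - (v : ℝ)⁻¹ < 1 / 2 := by
    have : (2 : ℝ)⁻¹ < (v : ℝ)⁻¹ := by gcongr; exact_mod_cast hv2
    linarith
  simp only [hsq]
  refine ⟨(integrable_exp_mul_sq_gaussianReal hs).1.const_mul _, ?_⟩
  rw [integral_const_mul, (integrable_exp_mul_sq_gaussianReal hs).2, ← mul_inv]
  congr 1
  nth_rw 1 [← Real.sqrt_sq hv'.le]
  rw [← Real.sqrt_mul (by positivity)]
  congr 1
  field_simp
  ring

lemma inv_sqrt_one_sub_sq_le_exp_sq {x : ℝ} (hx : x ^ 2 ≤ 1 / 2) :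
    (√(1 - x ^ 2))⁻¹ ≤ Real.exp (x ^ 2) := by
  rw [inv_le_iff_one_le_mul₀ (Real.sqrt_pos.2 (by linarith)),
    ← Real.sqrt_sq (Real.exp_pos (x ^ 2)).le, ← Real.sqrt_mul (by positivity), Real.one_le_sqrt,
    ← Real.exp_nat_mul]
  calc 1 ≤ (((2 : ℕ) : ℝ) * x ^ 2 + 1) * (1 - x ^ 2) := by
        push_cast
        nlinarith [sq_nonneg x]
    _ ≤ _ := mul_le_mul_of_nonneg_right (Real.add_one_le_exp _) (by linarith)

lemma memLp_sq_sub_one_gaussianReal {p : ℝ≥0∞} (hp : p ≠ ∞) :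
    MemLp (fun z ↦ z ^ 2 - 1) p (gaussianReal 0 1) :=
  (memLp_sq (memLp_id_gaussianReal' (2 * p) (by finiteness))).sub (memLp_const 1)

lemma integral_sq_sub_one_gaussianReal : ∫ z, (z ^ 2 - 1) ∂gaussianReal 0 1 = 0 := by
  rw [integral_sub (integrable_pow_gaussianReal 0 1 2) (integrable_const _),
    integral_pow_two_mul_gaussianReal 1]
  simp

lemma integral_sq_sub_one_pow_gaussianReal :
    ∫ z, (z ^ 2 - 1) ^ 2 ∂gaussianReal 0 1 = 2 ∧ ∫ z, (z ^ 2 - 1) ^ 4 ∂gaussianReal 0 1 = 60 := by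
  have hint (k : ℕ) := integrable_pow_gaussianReal 0 1 k
  have hmoment := integral_pow_two_mul_gaussianReal
  constructor
  · have hexpand (z : ℝ) : (z ^ 2 - 1) ^ 2 = z ^ (2 * 2) - 2 * z ^ (2 * 1) + 1 := by ring
    simp only [hexpand]
    rw [integral_add (by fun_prop) (by fun_prop), integral_sub (by fun_prop) (by fun_prop),
      integral_const_mul, hmoment, hmoment]
    norm_num [Nat.doubleFactorial]
  · have hexpand (z : ℝ) : (z ^ 2 - 1) ^ 4 =
        z ^ (2 * 4) - 4 * z ^ (2 * 3) + 6 * z ^ (2 * 2) - 4 * z ^ (2 * 1) + 1 := by ring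
    simp only [hexpand]
    rw [integral_add (by fun_prop) (by fun_prop), integral_sub (by fun_prop) (by fun_prop),
      integral_add (by fun_prop) (by fun_prop), integral_sub (by fun_prop) (by fun_prop),
      integral_const_mul, integral_const_mul, integral_const_mul, hmoment, hmoment, hmoment,
      hmoment]
    norm_num [Nat.doubleFactorial]

end GaussianReal

section FourthMoment

variable {Ω : Type*} [MeasurableSpace Ω] {μ : Measure Ω} {X Y : Ω → ℝ}

lemma integral_add_pow_four_of_indepFun [IsFiniteMeasure μ] (hXY : X ⟂ᵢ[μ] Y) (hX : MemLp X 4 μ)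
    (hY : MemLp Y 4 μ) (hX0 : ∫ ω, X ω ∂μ = 0) (hY0 : ∫ ω, Y ω ∂μ = 0) :
    ∫ ω, (X ω + Y ω) ^ 4 ∂μ =
      ∫ ω, X ω ^ 4 ∂μ + 6 * (∫ ω, X ω ^ 2 ∂μ) * ∫ ω, Y ω ^ 2 ∂μ + ∫ ω, Y ω ^ 4 ∂μ := by
  have hint {Z : Ω → ℝ} (hZ : MemLp Z 4 μ) {k : ℕ} (hk : k ≤ 4) :
      Integrable (fun ω ↦ Z ω ^ k) μ :=
    integrable_pow_of_memLp (p := 4) hZ hk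
  have hindep (j k : ℕ) : (fun ω ↦ X ω ^ j) ⟂ᵢ[μ] fun ω ↦ Y ω ^ k :=
    hXY.comp (measurable_id.pow_const j) (measurable_id.pow_const k)
  have hmul {j k : ℕ} (hj : j ≤ 4) (hk : k ≤ 4) : Integrable (fun ω ↦ X ω ^ j * Y ω ^ k) μ :=
    (hindep j k).integrable_mul (hint hX hj) (hint hY hk)
  have hprod (j k : ℕ) :
      ∫ ω, X ω ^ j * Y ω ^ k ∂μ = (∫ ω, X ω ^ j ∂μ) * ∫ ω, Y ω ^ k ∂μ :=
    (hindep j k).integral_fun_mul_eq_mul_integral (hX.1.pow j) (hY.1.pow k)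
  have h31 : Integrable (fun ω ↦ X ω ^ 3 * Y ω ^ 1) μ := hmul (by norm_num) (by norm_num)
  have h22 : Integrable (fun ω ↦ X ω ^ 2 * Y ω ^ 2) μ := hmul (by norm_num) (by norm_num)
  have h13 : Integrable (fun ω ↦ X ω ^ 1 * Y ω ^ 3) μ := hmul (by norm_num) (by norm_num)
  have hX4 : Integrable (fun ω ↦ X ω ^ 4) μ := hint hX le_rfl
  have hY4 : Integrable (fun ω ↦ Y ω ^ 4) μ := hint hY le_rfl
  have hbinom (ω : Ω) : (X ω + Y ω) ^ 4 = X ω ^ 4 + 4 * (X ω ^ 3 * Y ω ^ 1) +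
      6 * (X ω ^ 2 * Y ω ^ 2) + 4 * (X ω ^ 1 * Y ω ^ 3) + Y ω ^ 4 := by ring
  simp only [hbinom]
  rw [integral_add (by fun_prop) hY4, integral_add (by fun_prop) (by fun_prop),
    integral_add (by fun_prop) (by fun_prop), integral_add hX4 (by fun_prop),
    integral_const_mul, integral_const_mul, integral_const_mul, hprod, hprod, hprod]
  simp only [pow_one, hX0, hY0]
  ring

lemma integral_sum_pow_four_le {ι : Type*} {X : ι → Ω → ℝ} (hindep : iIndepFun X μ)
    (hX : ∀ i, MemLp (X i) 4 μ) (hX0 : ∀ i, ∫ ω, X i ω ∂μ = 0) {K : ℝ} (hK : 3 ≤ K)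
    (hkurt : ∀ i, ∫ ω, X i ω ^ 4 ∂μ ≤ K * (∫ ω, X i ω ^ 2 ∂μ) ^ 2) (s : Finset ι) :
    ∫ ω, (∑ i ∈ s, X i ω) ^ 4 ∂μ ≤ K * (∑ i ∈ s, ∫ ω, X i ω ^ 2 ∂μ) ^ 2 := by
  have := hindep.isProbabilityMeasure
  have hX2 (i : ι) : MemLp (X i) 2 μ := (hX i).mono_exponent (by norm_num)
  have hmean (s : Finset ι) : ∫ ω, ∑ i ∈ s, X i ω ∂μ = 0 := by
    rw [integral_finsetSum _ fun i _ ↦ (hX2 i).integrable one_le_two]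
    exact Finset.sum_eq_zero fun i _ ↦ hX0 i
  have hvar (s : Finset ι) : ∫ ω, (∑ i ∈ s, X i ω) ^ 2 ∂μ = ∑ i ∈ s, ∫ ω, X i ω ^ 2 ∂μ := by
    have h := IndepFun.variance_sum (s := s) (fun i _ ↦ hX2 i)
      fun i _ j _ hij ↦ hindep.indepFun hij
    have hsum : ∑ i ∈ s, X i = fun ω ↦ ∑ i ∈ s, X i ω := by ext; simp
    rw [hsum, variance_of_integral_eq_zero
      (memLp_finsetSum s fun i _ ↦ hX2 i).1.aemeasurable (hmean s)] at h
    exact h.trans (Finset.sum_congr rfl fun i _ ↦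
      variance_of_integral_eq_zero (hX i).1.aemeasurable (hX0 i))
  classical
  induction s using Finset.induction_on with
  | empty => simp
  | insert a s ha ih =>
    have hindep_sum : X a ⟂ᵢ[μ] fun ω ↦ ∑ i ∈ s, X i ω := by
      have h := hindep.indepFun_finsetSum_of_notMem₀ (fun i ↦ (hX i).1.aemeasurable) ha
      simpa only [Finset.sum_fn] using h.symm
    simp only [Finset.sum_insert ha]
    rw [integral_add_pow_four_of_indepFun hindep_sum (hX a) (memLp_finsetSum s fun i _ ↦ hX i)
      (hX0 a) (hmean s), hvar]
    have ha2 : 0 ≤ ∫ ω, X a ω ^ 2 ∂μ := integral_nonneg fun _ ↦ sq_nonneg _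
    have hs2 : 0 ≤ ∑ i ∈ s, ∫ ω, X i ω ^ 2 ∂μ :=
      Finset.sum_nonneg fun i _ ↦ integral_nonneg fun _ ↦ sq_nonneg _
    -- The cross term `6 σ² τ²` is at most the `2 K σ² τ²` in the expansion of `K (σ² + τ²)²`.
    nlinarith [hkurt a, mul_nonneg ha2 hs2]

end FourthMoment

section Eigenbasis

lemma pi_withDensity {ι : Type*} [Fintype ι] {E : ι → Type*} [∀ i, MeasurableSpace (E i)]
    (μ : ∀ i, Measure (E i)) [∀ i, IsProbabilityMeasure (μ i)] {f : ∀ i, E i → ℝ≥0∞}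
    (hf : ∀ i, Measurable (f i)) [∀ i, SigmaFinite ((μ i).withDensity (f i))] :
    (Measure.pi fun i ↦ (μ i).withDensity (f i)) =
      (Measure.pi μ).withDensity fun x ↦ ∏ i, f i (x i) := by
  refine Measure.pi_eq fun s hs ↦ ?_
  have hbox : MeasurableSet (Set.univ.pi s) := .univ_pi hs
  have hfs (i : ι) : Measurable ((s i).indicator (f i)) := (hf i).indicator (hs i)
  have hindicator (x : ∀ i, E i) : (Set.univ.pi s).indicator (fun x ↦ ∏ i, f i (x i)) x =
      ∏ i, (s i).indicator (f i) (x i) := by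
    by_cases hx : x ∈ Set.univ.pi s
    · rw [Set.indicator_of_mem hx]
      exact Finset.prod_congr rfl fun i _ ↦ (Set.indicator_of_mem (hx i trivial) _).symm
    · rw [Set.indicator_of_notMem hx]
      obtain ⟨i, -, hi⟩ : ∃ i ∈ Set.univ, x i ∉ s i := by simpa [Set.mem_pi] using hx
      exact (Finset.prod_eq_zero (Finset.mem_univ i) (Set.indicator_of_notMem hi _)).symm
  have hindep : iIndepFun (fun i x ↦ (s i).indicator (f i) (x i)) (Measure.pi μ) :=
    iIndepFun_pi fun i ↦ (hfs i).aemeasurable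
  rw [withDensity_apply _ hbox, ← lintegral_indicator hbox]
  simp only [hindicator]
  rw [lintegral_prod_eq_prod_lintegral_of_indepFun _ _ hindep fun i ↦
    (hfs i).comp (measurable_pi_apply i)]
  refine Finset.prod_congr rfl fun i _ ↦ ?_
  rw [(measurePreserving_eval μ i).lintegral_comp (hfs i), lintegral_indicator (hs i),
    withDensity_apply _ (hs i)]

variable {ι κ : Type*} [Fintype ι] [Fintype κ]

lemma measurePreserving_repr_stdGaussian (b : OrthonormalBasis ι ℝ (EuclideanSpace ℝ κ)) :
    MeasurePreserving (fun x i ↦ b.repr x i) (stdGaussian (EuclideanSpace ℝ κ))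
      (Measure.pi fun _ ↦ gaussianReal 0 1) := by
  classical
  have hrepr : Measurable fun (x : EuclideanSpace ℝ κ) i ↦ b.repr x i := by fun_prop
  refine ⟨hrepr, ?_⟩
  rw [stdGaussian_eq_map_pi_orthonormalBasis b, Measure.map_map hrepr (by fun_prop)]
  convert Measure.map_id
  ext y i
  simp [b.repr_apply_apply, inner_sum, inner_smul_right, b.inner_eq_ite]

lemma dotProduct_mulVec_eq_sum (b : OrthonormalBasis ι ℝ (EuclideanSpace ℝ κ))
    (A : Matrix κ κ ℝ) (e : ι → ℝ) (hA : ∀ i, A.mulVec (b i) = e i • (b i).ofLp)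
    (x : EuclideanSpace ℝ κ) :
    x ⬝ᵥ A.mulVec x = ∑ i, e i * b.repr x i ^ 2 := by
  classical
  have hA' (i : ι) : Matrix.toEuclideanLin A (b i) = e i • b i := by
    ext j
    simp [Matrix.toLpLin_apply, hA]
  calc x ⬝ᵥ A.mulVec x = ⟪x, Matrix.toEuclideanLin A x⟫ := by
        simp [EuclideanSpace.inner_eq_star_dotProduct, Matrix.toLpLin_apply, dotProduct_comm]
    _ = ⟪x, Matrix.toEuclideanLin A (∑ i, b.repr x i • b i)⟫ := by rw [b.sum_repr]
    _ = ∑ i, e i * b.repr x i ^ 2 := by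
        simp only [map_sum, map_smul, hA', inner_sum, inner_smul_right]
        refine Finset.sum_congr rfl fun i _ ↦ ?_
        rw [b.repr_apply_apply, real_inner_comm]
        ring

variable [DecidableEq κ]

lemma multivariateGaussian_eq_map_pi (b : OrthonormalBasis ι ℝ (EuclideanSpace ℝ κ))
    {A : Matrix κ κ ℝ} (hA : A.PosSemidef) (v : ι → ℝ≥0)
    (hv : ∀ i, A.mulVec (b i) = (v i : ℝ) • (b i).ofLp) :
    multivariateGaussian 0 A =
      (Measure.pi fun i ↦ gaussianReal 0 (v i)).map fun y ↦ ∑ i, y i • b i := by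
  refine Measure.ext_of_charFun (funext fun t ↦ ?_)
  rw [charFun_multivariateGaussian hA, charFun_apply,
    integral_map (Measurable.aemeasurable (by fun_prop))
      (Measurable.aestronglyMeasurable (by fun_prop))]
  simp_rw [sum_inner, Complex.ofReal_sum, Finset.sum_mul, Complex.exp_sum]
  rw [integral_fintype_prod_eq_prod
    (f := fun i (x : ℝ) ↦ Complex.exp (⟪x • b i, t⟫ * Complex.I))]
  simp_rw [real_inner_smul_left, mul_comm _ (⟪_, _⟫), Complex.ofReal_mul, ← charFun_apply_real,
    charFun_gaussianReal, ← Complex.exp_sum]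
  rw [dotProduct_mulVec_eq_sum b A _ hv t]
  simp [b.repr_apply_apply, Finset.sum_div]

lemma multivariateGaussian_eq_withDensity (b : OrthonormalBasis ι ℝ (EuclideanSpace ℝ κ))
    {A : Matrix κ κ ℝ} (hA : A.PosSemidef) (v : ι → ℝ≥0) (hv0 : ∀ i, v i ≠ 0)
    (hv : ∀ i, A.mulVec (b i) = (v i : ℝ) • (b i).ofLp) :
    multivariateGaussian 0 A = (stdGaussian (EuclideanSpace ℝ κ)).withDensity fun x ↦
      ENNReal.ofReal (∏ i, gaussianRatio (v i) (b.repr x i)) := by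
  classical
  have hsum : Measurable fun y : ι → ℝ ↦ ∑ i, y i • b i := by fun_prop
  have hdensity : Measurable fun x : EuclideanSpace ℝ κ ↦
      ENNReal.ofReal (∏ i, gaussianRatio (v i) (b.repr x i)) := by fun_prop
  have hsigma (i : ι) : SigmaFinite
      ((gaussianReal 0 1).withDensity fun z ↦ ENNReal.ofReal (gaussianRatio (v i) z)) := by
    rw [← gaussianReal_eq_withDensity_gaussianRatio (hv0 i)]
    infer_instance
  have hrepr (y : ι → ℝ) (i : ι) : b.repr (∑ i, y i • b i) i = y i := by simp [Pi.single_apply]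
  rw [multivariateGaussian_eq_map_pi b hA v hv, stdGaussian_eq_map_pi_orthonormalBasis b]
  simp_rw [fun i ↦ gaussianReal_eq_withDensity_gaussianRatio (hv0 i)]
  rw [pi_withDensity _ fun i ↦ (measurable_gaussianRatio (v i)).ennreal_ofReal]
  ext s hs
  rw [Measure.map_apply hsum hs, withDensity_apply _ (hsum hs), withDensity_apply _ hs,
    setLIntegral_map hs hdensity hsum]
  simp only [hrepr, ENNReal.ofReal_prod_of_nonneg fun _ _ ↦ gaussianRatio_nonneg _ _]

lemma memLp_sum_mul_sq_sub_one (e : ι → ℝ) {p : ℝ≥0∞} (hp : p ≠ ∞) :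
    MemLp (fun y : ι → ℝ ↦ ∑ i, e i * (y i ^ 2 - 1)) p (Measure.pi fun _ ↦ gaussianReal 0 1) :=
  memLp_finsetSum _ fun i _ ↦ ((memLp_sq_sub_one_gaussianReal hp).comp_measurePreserving
    (measurePreserving_eval (fun _ ↦ gaussianReal 0 1) i)).const_mul (e i)

lemma integral_sum_mul_sq_sub_one_pow_four_le (e : ι → ℝ) :
    ∫ y : ι → ℝ, (∑ i, e i * (y i ^ 2 - 1)) ^ 4 ∂(Measure.pi fun _ ↦ gaussianReal 0 1) ≤
      60 * (∑ i, e i ^ 2) ^ 2 := by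
  have hmoment (i : ι) (k : ℕ) :
      ∫ y : ι → ℝ, (e i * (y i ^ 2 - 1)) ^ k ∂(Measure.pi fun _ ↦ gaussianReal 0 1) =
        e i ^ k * ∫ z, (z ^ 2 - 1) ^ k ∂gaussianReal 0 1 := by
    simp only [mul_pow]
    rw [integral_const_mul, integral_comp_eval (X := fun _ : ι ↦ ℝ) (i := i)
      (f := fun z ↦ (z ^ 2 - 1) ^ k) (Measurable.aestronglyMeasurable (by fun_prop))]
  -- `15 = 60 / 2²` is the kurtosis of `z² - 1`.
  have h := integral_sum_pow_four_le (K := 15)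
    (iIndepFun_pi (X := fun i z ↦ e i * (z ^ 2 - 1)) (μ := fun _ ↦ gaussianReal 0 1)
      fun i ↦ Measurable.aemeasurable (by fun_prop))
    (fun i ↦ ((memLp_sq_sub_one_gaussianReal (by simp)).comp_measurePreserving
      (measurePreserving_eval (fun _ ↦ gaussianReal 0 1) i)).const_mul (e i))
    (fun i ↦ by simpa [integral_sq_sub_one_gaussianReal] using hmoment i 1) (by norm_num)
    (fun i ↦ by
      rw [hmoment, hmoment, integral_sq_sub_one_pow_gaussianReal.1,
        integral_sq_sub_one_pow_gaussianReal.2]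
      exact le_of_eq (by ring)) Finset.univ
  refine h.trans_eq ?_
  simp only [hmoment, integral_sq_sub_one_pow_gaussianReal.1, ← Finset.sum_mul]
  ring

end Eigenbasis

section ChiSquare

variable {ι κ : Type*} [Fintype ι] [Fintype κ] [DecidableEq κ]

lemma integral_prod_gaussianRatio_sq {v : ι → ℝ≥0} (hv0 : ∀ i, v i ≠ 0) (hv2 : ∀ i, v i < 2) :
    Integrable (fun y : ι → ℝ ↦ (∏ i, gaussianRatio (v i) (y i)) ^ 2)
        (Measure.pi fun _ ↦ gaussianReal 0 1) ∧
      ∫ y : ι → ℝ, (∏ i, gaussianRatio (v i) (y i)) ^ 2 ∂(Measure.pi fun _ ↦ gaussianReal 0 1) =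
        ∏ i, (√(1 - ((v i : ℝ) - 1) ^ 2))⁻¹ := by
  simp only [← Finset.prod_pow]
  refine ⟨Integrable.fintype_prod_dep (f := fun i z ↦ gaussianRatio (v i) z ^ 2)
    fun i ↦ (integral_gaussianRatio_sq (hv0 i) (hv2 i)).1, ?_⟩
  rw [integral_fintype_prod_eq_prod fun i z ↦ gaussianRatio (v i) z ^ 2]
  exact Finset.prod_congr rfl fun i _ ↦ (integral_gaussianRatio_sq (hv0 i) (hv2 i)).2

lemma chiSqDiv_multivariateGaussian_eq (b : OrthonormalBasis ι ℝ (EuclideanSpace ℝ κ))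
    {A : Matrix κ κ ℝ} (hA : A.PosSemidef) {v : ι → ℝ≥0} (hv0 : ∀ i, v i ≠ 0)
    (hv2 : ∀ i, v i < 2) (hv : ∀ i, A.mulVec (b i) = (v i : ℝ) • (b i).ofLp) :
    multivariateGaussian 0 A ≪ stdGaussian (EuclideanSpace ℝ κ) ∧
      MemLp (fun x ↦ ((multivariateGaussian 0 A).rnDeriv (stdGaussian _) x).toReal) 2
        (stdGaussian (EuclideanSpace ℝ κ)) ∧
      chiSqDiv (multivariateGaussian 0 A) (stdGaussian (EuclideanSpace ℝ κ)) =
        ∏ i, (√(1 - ((v i : ℝ) - 1) ^ 2))⁻¹ - 1 := by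
  have hdensity := multivariateGaussian_eq_withDensity b hA v hv0 hv
  have hac : multivariateGaussian 0 A ≪ stdGaussian (EuclideanSpace ℝ κ) :=
    hdensity ▸ withDensity_absolutelyContinuous _ _
  have hrn : (fun x ↦ ((multivariateGaussian 0 A).rnDeriv (stdGaussian _) x).toReal)
      =ᵐ[stdGaussian (EuclideanSpace ℝ κ)] fun x ↦ ∏ i, gaussianRatio (v i) (b.repr x i) := by
    rw [hdensity]
    filter_upwards [Measure.rnDeriv_withDensity (stdGaussian (EuclideanSpace ℝ κ))
      (f := fun x ↦ ENNReal.ofReal (∏ i, gaussianRatio (v i) (b.repr x i))) (by fun_prop)]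
      with x hx
    rw [hx, ENNReal.toReal_ofReal (Finset.prod_nonneg fun i _ ↦ gaussianRatio_nonneg _ _)]
  have hrepr := measurePreserving_repr_stdGaussian b
  obtain ⟨hint, hvalue⟩ := integral_prod_gaussianRatio_sq hv0 hv2
  have hL2 : MemLp (fun x ↦ ((multivariateGaussian 0 A).rnDeriv (stdGaussian _) x).toReal) 2
      (stdGaussian (EuclideanSpace ℝ κ)) := by
    rw [memLp_congr_ae hrn, memLp_two_iff_integrable_sq
      (Measurable.aestronglyMeasurable (by fun_prop))]
    exact hrepr.integrable_comp_of_integrable hint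
  refine ⟨hac, hL2, ?_⟩
  rw [chiSqDiv_eq_integral_sq_sub_one hac hL2, ← hvalue,
    ← hrepr.hasLaw.integral_comp hint.aestronglyMeasurable]
  congr 1
  exact integral_congr_ae (hrn.fun_comp (· ^ 2))

end ChiSquare

section Frobenius

variable {d : ℕ}

lemma frobeniusSq_nonneg (A : Matrix (Fin d) (Fin d) ℝ) : 0 ≤ frobeniusSq A :=
  Finset.sum_nonneg fun _ _ ↦ Finset.sum_nonneg fun _ _ ↦ sq_nonneg _

lemma frobeniusSq_eq_sum_sq {ι : Type*} [Fintype ι]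
    (b : OrthonormalBasis ι ℝ (EuclideanSpace ℝ (Fin d))) {A : Matrix (Fin d) (Fin d) ℝ}
    {e : ι → ℝ} (hA : ∀ k, A.mulVec (b k) = e k • (b k).ofLp) :
    frobeniusSq A = ∑ k, e k ^ 2 := by
  have hrow (i : Fin d) : ∑ j, A i j ^ 2 = ∑ k, (e k * b k i) ^ 2 := calc
    ∑ j, A i j ^ 2 = ‖WithLp.toLp 2 (A i)‖ ^ 2 := by simp [EuclideanSpace.norm_sq_eq]
    _ = ∑ k, ⟪WithLp.toLp 2 (A i), b k⟫ ^ 2 := by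
      simp [← b.sum_sq_norm_inner_left (WithLp.toLp 2 (A i))]
    _ = ∑ k, (e k * b k i) ^ 2 := by
      refine Finset.sum_congr rfl fun k _ ↦ congrArg (· ^ 2) ?_
      rw [EuclideanSpace.inner_eq_star_dotProduct, star_trivial, dotProduct_comm]
      exact congrFun (hA k) i
  have hnorm (k : ι) : ∑ i, b k i ^ 2 = 1 := by
    rw [← EuclideanSpace.real_norm_sq_eq, b.norm_eq_one, one_pow]
  simp only [frobeniusSq, hrow, mul_pow]
  rw [Finset.sum_comm]
  simp only [← Finset.mul_sum, hnorm, mul_one]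

lemma posSemidef_of_eigenbasis {ι : Type*} [Fintype ι]
    (b : OrthonormalBasis ι ℝ (EuclideanSpace ℝ (Fin d))) {A : Matrix (Fin d) (Fin d) ℝ}
    (hA : A.IsHermitian) {e : ι → ℝ} (he : ∀ i, A.mulVec (b i) = e i • (b i).ofLp)
    (he0 : ∀ i, 0 ≤ e i) : A.PosSemidef :=
  .of_dotProduct_mulVec_nonneg hA fun x ↦ by
    rw [star_trivial, dotProduct_mulVec_eq_sum b A e he (WithLp.toLp 2 x)]
    exact Finset.sum_nonneg fun i _ ↦ mul_nonneg (he0 i) (sq_nonneg _)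

lemma WellConditioned.posSemidef {S : Matrix (Fin d) (Fin d) ℝ} (hS : WellConditioned S) :
    S.PosSemidef := by
  simpa using hS.1.add (Matrix.PosSemidef.one.smul (by norm_num : (0 : ℝ) ≤ 1 / 2))

variable {S : Matrix (Fin d) (Fin d) ℝ}

lemma frobeniusSq_sub_one_eq_sum (hS : S.IsHermitian) :
    frobeniusSq (S - 1) = ∑ i, (hS.eigenvalues i - 1) ^ 2 :=
  frobeniusSq_eq_sum_sq hS.eigenvectorBasis fun i ↦ by
    rw [Matrix.sub_mulVec, hS.mulVec_eigenvectorBasis, Matrix.one_mulVec, sub_smul, one_smul]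

lemma abs_eigenvalues_sub_one_le (hS : S.IsHermitian) (hF : frobeniusSq (S - 1) ≤ 1 / 4)
    (i : Fin d) : |hS.eigenvalues i - 1| ≤ 1 / 2 := by
  refine abs_le_of_sq_le_sq ?_ (by norm_num)
  calc (hS.eigenvalues i - 1) ^ 2 ≤ ∑ j, (hS.eigenvalues j - 1) ^ 2 :=
        Finset.single_le_sum (f := fun j ↦ (hS.eigenvalues j - 1) ^ 2)
          (fun j _ ↦ sq_nonneg _) (Finset.mem_univ i)
    _ = frobeniusSq (S - 1) := (frobeniusSq_sub_one_eq_sum hS).symm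
    _ ≤ (1 / 2) ^ 2 := hF.trans_eq (by norm_num)

lemma wellConditioned_of_frobeniusSq_sub_one_le (hS : S.IsHermitian)
    (hF : frobeniusSq (S - 1) ≤ 1 / 4) : WellConditioned S := by
  have hle (i : Fin d) := abs_le.1 (abs_eigenvalues_sub_one_le hS hF i)
  have hscalar (c : ℝ) : (c • (1 : Matrix (Fin d) (Fin d) ℝ)).IsHermitian := by
    simp [Matrix.IsHermitian]
  have hmul (i : Fin d) := hS.mulVec_eigenvectorBasis i
  constructor
  · refine posSemidef_of_eigenbasis hS.eigenvectorBasis (e := fun i ↦ hS.eigenvalues i - 1 / 2)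
      (hS.sub (hscalar _)) (fun i ↦ ?_) fun i ↦ by linarith [(hle i).1]
    rw [Matrix.sub_mulVec, hmul, Matrix.smul_mulVec, Matrix.one_mulVec, sub_smul]
  · refine posSemidef_of_eigenbasis hS.eigenvectorBasis (e := fun i ↦ 3 / 2 - hS.eigenvalues i)
      ((hscalar _).sub hS) (fun i ↦ ?_) fun i ↦ by linarith [(hle i).2]
    rw [Matrix.sub_mulVec, hmul, Matrix.smul_mulVec, Matrix.one_mulVec, sub_smul]

lemma chiSqDiv_multivariateGaussian_le (hS : S.IsHermitian) (hF : frobeniusSq (S - 1) ≤ 1 / 4) :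
    multivariateGaussian 0 S ≪ stdGaussian (EuclideanSpace ℝ (Fin d)) ∧
      MemLp (fun x ↦ ((multivariateGaussian 0 S).rnDeriv (stdGaussian _) x).toReal) 2
        (stdGaussian (EuclideanSpace ℝ (Fin d))) ∧
      chiSqDiv (multivariateGaussian 0 S) (stdGaussian (EuclideanSpace ℝ (Fin d))) ≤
        2 * frobeniusSq (S - 1) := by
  have hle (i : Fin d) := abs_le.1 (abs_eigenvalues_sub_one_le hS hF i)
  let v (i : Fin d) : ℝ≥0 := ⟨hS.eigenvalues i, by linarith [(hle i).1]⟩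
  have hv0 (i : Fin d) : v i ≠ 0 := by
    rw [← NNReal.coe_ne_zero]
    exact (show 0 < hS.eigenvalues i by linarith [(hle i).1]).ne'
  have hv2 (i : Fin d) : v i < 2 := by
    rw [← NNReal.coe_lt_coe]
    exact (show hS.eigenvalues i < 2 by linarith [(hle i).2])
  obtain ⟨hac, hL2, hchi⟩ := chiSqDiv_multivariateGaussian_eq hS.eigenvectorBasis
    (wellConditioned_of_frobeniusSq_sub_one_le hS hF).posSemidef hv0 hv2
    hS.mulVec_eigenvectorBasis
  refine ⟨hac, hL2, ?_⟩
  have h0 := frobeniusSq_nonneg (S - 1)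
  calc chiSqDiv (multivariateGaussian 0 S) (stdGaussian (EuclideanSpace ℝ (Fin d)))
      = ∏ i, (√(1 - (hS.eigenvalues i - 1) ^ 2))⁻¹ - 1 := hchi
    _ ≤ ∏ i, Real.exp ((hS.eigenvalues i - 1) ^ 2) - 1 := by
        gcongr with i
        exact inv_sqrt_one_sub_sq_le_exp_sq (by nlinarith [hle i])
    _ = Real.exp (frobeniusSq (S - 1)) - 1 := by
        rw [← Real.exp_sum, frobeniusSq_sub_one_eq_sum hS]
    _ ≤ 2 * frobeniusSq (S - 1) := by
        have := Real.abs_exp_sub_one_le (x := frobeniusSq (S - 1))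
          (by rw [abs_of_nonneg h0]; linarith)
        rw [abs_of_nonneg h0] at this
        exact (le_abs_self _).trans this

end Frobenius

section QuadraticForm

lemma integral_mul_multivariateGaussian {κ : Type*} [Fintype κ] [DecidableEq κ]
    {S : Matrix κ κ ℝ} (hS : S.PosSemidef) (i j : κ) :
    Integrable (fun x : EuclideanSpace ℝ κ ↦ x i * x j) (multivariateGaussian 0 S) ∧
      ∫ x : EuclideanSpace ℝ κ, x i * x j ∂(multivariateGaussian 0 S) = S i j := by
  have hmem (k : κ) : MemLp (fun x : EuclideanSpace ℝ κ ↦ x k) 2 (multivariateGaussian 0 S) :=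
    IsGaussian.memLp_two_id.continuousLinearMap_comp
      (EuclideanSpace.proj k : EuclideanSpace ℝ κ →L[ℝ] ℝ)
  have hmean (k : κ) : ∫ x : EuclideanSpace ℝ κ, x k ∂(multivariateGaussian 0 S) = 0 := by
    simpa using (EuclideanSpace.proj (𝕜 := ℝ) k : EuclideanSpace ℝ κ →L[ℝ] ℝ).integral_comp_comm
      (IsGaussian.integrable_id (μ := multivariateGaussian 0 S))
  refine ⟨(hmem i).integrable_mul (hmem j), ?_⟩
  have hcov := covariance_eval_multivariateGaussian (μ := 0) hS i j
  rw [covariance_eq_sub (hmem i) (hmem j), hmean, hmean] at hcov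
  simpa using hcov

lemma integral_dotProduct_mulVec_multivariateGaussian {κ : Type*} [Fintype κ] [DecidableEq κ]
    {S : Matrix κ κ ℝ} (hS : S.PosSemidef) (D : Matrix κ κ ℝ) :
    Integrable (fun x : EuclideanSpace ℝ κ ↦ x ⬝ᵥ D.mulVec x) (multivariateGaussian 0 S) ∧
      ∫ x : EuclideanSpace ℝ κ, x ⬝ᵥ D.mulVec x ∂(multivariateGaussian 0 S) =
        ∑ i, ∑ j, D i j * S i j := by
  have hexpand (x : EuclideanSpace ℝ κ) :
      x ⬝ᵥ D.mulVec x = ∑ i, ∑ j, D i j * (x i * x j) := by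
    simp only [dotProduct, Matrix.mulVec, Finset.mul_sum]
    exact Finset.sum_congr rfl fun i _ ↦ Finset.sum_congr rfl fun j _ ↦ by ring
  have hint (i j : κ) : Integrable (fun x : EuclideanSpace ℝ κ ↦ D i j * (x i * x j))
      (multivariateGaussian 0 S) := (integral_mul_multivariateGaussian hS i j).1.const_mul _
  simp only [hexpand]
  refine ⟨integrable_finsetSum _ fun i _ ↦ integrable_finsetSum _ fun j _ ↦ hint i j, ?_⟩
  rw [integral_finsetSum _ fun i _ ↦ integrable_finsetSum _ fun j _ ↦ hint i j]
  simp only [integral_finsetSum _ fun j _ ↦ hint _ j, integral_const_mul,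
    (integral_mul_multivariateGaussian hS _ _).2]

variable {d : ℕ} {S T D : Matrix (Fin d) (Fin d) ℝ}

lemma integral_dotProduct_mulVec_sub_trace_pow_four_le (hD : D.IsHermitian) :
    MemLp (fun x : EuclideanSpace ℝ (Fin d) ↦ x ⬝ᵥ D.mulVec x - D.trace) 4
        (stdGaussian (EuclideanSpace ℝ (Fin d))) ∧
      ∫ x : EuclideanSpace ℝ (Fin d), (x ⬝ᵥ D.mulVec x - D.trace) ^ 4
        ∂(stdGaussian (EuclideanSpace ℝ (Fin d))) ≤ 60 * frobeniusSq D ^ 2 := by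
  have hdiag (x : EuclideanSpace ℝ (Fin d)) : x ⬝ᵥ D.mulVec x - D.trace =
      ∑ i, hD.eigenvalues i * (hD.eigenvectorBasis.repr x i ^ 2 - 1) := by
    rw [dotProduct_mulVec_eq_sum _ _ _ hD.mulVec_eigenvectorBasis, hD.trace_eq_sum_eigenvalues]
    simp [mul_sub, Finset.sum_sub_distrib]
  have hrepr := measurePreserving_repr_stdGaussian hD.eigenvectorBasis
  have hmem := memLp_sum_mul_sq_sub_one hD.eigenvalues (p := 4) (by simp)
  simp only [hdiag]
  refine ⟨hmem.comp_measurePreserving hrepr, ?_⟩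
  rw [frobeniusSq_eq_sum_sq hD.eigenvectorBasis hD.mulVec_eigenvectorBasis]
  refine le_trans (le_of_eq ?_) (integral_sum_mul_sq_sub_one_pow_four_le hD.eigenvalues)
  exact hrepr.hasLaw.integral_comp (hmem.1.pow 4)

lemma frobeniusSq_sub_eq_integral_sub_integral (hS : S.PosSemidef) (hT : T.PosSemidef) (c : ℝ) :
    frobeniusSq (S - T) =
      ∫ x : EuclideanSpace ℝ (Fin d), (x ⬝ᵥ (S - T).mulVec x - c) ∂(multivariateGaussian 0 S) -
        ∫ x : EuclideanSpace ℝ (Fin d), (x ⬝ᵥ (S - T).mulVec x - c)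
          ∂(multivariateGaussian 0 T) := by
  obtain ⟨hintS, hvalueS⟩ := integral_dotProduct_mulVec_multivariateGaussian hS (S - T)
  obtain ⟨hintT, hvalueT⟩ := integral_dotProduct_mulVec_multivariateGaussian hT (S - T)
  rw [integral_sub hintS (integrable_const c), integral_sub hintT (integrable_const c), hvalueS,
    hvalueT]
  simp only [integral_const, probReal_univ, one_smul, sub_sub_sub_cancel_right, frobeniusSq,
    ← Finset.sum_sub_distrib, Matrix.sub_apply]
  exact Finset.sum_congr rfl fun i _ ↦ Finset.sum_congr rfl fun j _ ↦ by ring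

/-- The test function is the quadratic form of `S - T`, centred under the standard Gaussian. -/
lemma sq_frobeniusSq_sub_le_tvDist {ρ : ℝ} (hρ : ρ ^ 2 ≤ 1 / 4) (hS : S.IsHermitian)
    (hT : T.IsHermitian) (hSρ : frobeniusSq (S - 1) ≤ ρ ^ 2) (hTρ : frobeniusSq (T - 1) ≤ ρ ^ 2) :
    frobeniusSq (S - T) ^ 2 ≤
      1920 * ρ ^ 2 * tvDist (multivariateGaussian 0 S) (multivariateGaussian 0 T) ^ 2 := by
  have hSpos := (wellConditioned_of_frobeniusSq_sub_one_le hS (hSρ.trans hρ)).posSemidef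
  have hTpos := (wellConditioned_of_frobeniusSq_sub_one_le hT (hTρ.trans hρ)).posSemidef
  obtain ⟨hSac, hSL2, hSchi⟩ := chiSqDiv_multivariateGaussian_le hS (hSρ.trans hρ)
  obtain ⟨hTac, hTL2, hTchi⟩ := chiSqDiv_multivariateGaussian_le hT (hTρ.trans hρ)
  obtain ⟨hmem, hmoment⟩ := integral_dotProduct_mulVec_sub_trace_pow_four_le (hS.sub hT)
  have hholder := pow_four_integral_sub_integral_le_tvDist hSac hTac hSL2 hTL2 hmem
  rw [← frobeniusSq_sub_eq_integral_sub_integral hSpos hTpos] at hholder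
  set F := frobeniusSq (S - T)
  set t := tvDist (multivariateGaussian 0 S) (multivariateGaussian 0 T)
  have hF4 : F ^ 4 ≤ (2 * t) ^ 2 * (2 * (2 * ρ ^ 2 + 2 * ρ ^ 2)) * (60 * F ^ 2) :=
    hholder.trans (by gcongr <;> linarith)
  rcases eq_or_ne F 0 with hF0 | hF0
  · rw [hF0, zero_pow two_ne_zero]
    positivity
  · refine le_of_mul_le_mul_right ?_ (by positivity : 0 < F ^ 2)
    linarith

lemma div_le_tvDist_multivariateGaussian {ρ : ℝ} (hρ0 : 0 < ρ) (hρ : ρ ≤ 1 / 2)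
    (hS : S.IsHermitian) (hT : T.IsHermitian) (hSρ : frobeniusSq (S - 1) ≤ ρ ^ 2)
    (hTρ : frobeniusSq (T - 1) ≤ ρ ^ 2) (hST : 3 / 4 * ρ ^ 2 ≤ frobeniusSq (S - T)) :
    ρ / 60 ≤ tvDist (multivariateGaussian 0 S) (multivariateGaussian 0 T) := by
  have htv := sq_frobeniusSq_sub_le_tvDist (by nlinarith) hS hT hSρ hTρ
  set t := tvDist (multivariateGaussian 0 S) (multivariateGaussian 0 T)
  have ht : 0 ≤ t := Real.iSup_nonneg fun _ ↦ abs_nonneg _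
  have hF : (3 / 4 * ρ ^ 2) ^ 2 ≤ 1920 * ρ ^ 2 * t ^ 2 := le_trans (by gcongr) htv
  refine (pow_le_pow_iff_left₀ (by positivity) ht two_ne_zero).1 ?_
  refine le_of_mul_le_mul_right ?_ (by positivity : 0 < ρ ^ 2)
  nlinarith [sq_nonneg (ρ ^ 2)]

end QuadraticForm

section Packing

variable {d : ℕ}

/-- The identity matrix with every entry shifted by `± ρ / d`. The signs form a binary word indexed
by unordered pairs, so that the resulting matrix is symmetric. -/
noncomputable def perturbedIdentity (ρ : ℝ) (a : Sym2 (Fin d) → Bool) : Matrix (Fin d) (Fin d) ℝ :=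
  1 + Matrix.of fun i j ↦ ρ / d * if a s(i, j) then 1 else -1

lemma isHermitian_perturbedIdentity (ρ : ℝ) (a : Sym2 (Fin d) → Bool) :
    (perturbedIdentity ρ a).IsHermitian := by
  refine Matrix.isHermitian_one.add ?_
  ext i j
  simp [Sym2.eq_swap]

lemma frobeniusSq_perturbedIdentity_sub_one (hd : 0 < d) (ρ : ℝ) (a : Sym2 (Fin d) → Bool) :
    frobeniusSq (perturbedIdentity ρ a - 1) = ρ ^ 2 := by
  simp only [perturbedIdentity, add_sub_cancel_left, frobeniusSq, Matrix.of_apply, mul_pow,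
    ite_pow, one_pow, even_two.neg_pow, ite_self, mul_one, Finset.sum_const, Finset.card_univ,
    Fintype.card_fin, nsmul_eq_mul]
  field_simp

lemma mul_hammingDist_le_frobeniusSq_sub (ρ : ℝ) (a b : Sym2 (Fin d) → Bool) :
    4 * (ρ / d) ^ 2 * hammingDist a b ≤
      frobeniusSq (perturbedIdentity ρ a - perturbedIdentity ρ b) := by
  have hfrob : frobeniusSq (perturbedIdentity ρ a - perturbedIdentity ρ b) =
      4 * (ρ / d) ^ 2 * (Finset.univ.filter fun p : Fin d × Fin d ↦
        a s(p.1, p.2) ≠ b s(p.1, p.2)).card := by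
    rw [frobeniusSq, ← Finset.sum_product', Finset.univ_product_univ, mul_comm,
      ← nsmul_eq_mul, ← Finset.sum_const, Finset.sum_filter]
    refine Finset.sum_congr rfl fun p _ ↦ ?_
    cases ha : a s(p.1, p.2) <;> cases hb : b s(p.1, p.2) <;>
      simp [perturbedIdentity, ha, hb] <;> ring
  have hcard : hammingDist a b ≤ (Finset.univ.filter fun p : Fin d × Fin d ↦
      a s(p.1, p.2) ≠ b s(p.1, p.2)).card := by
    refine Finset.card_le_card_of_surjOn (fun p ↦ s(p.1, p.2)) fun e he ↦ ?_
    induction e using Sym2.ind with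
    | _ i j => exact ⟨(i, j), by simpa using he, rfl⟩
  rw [hfrob]
  gcongr

lemma sq_div_two_le_card_sym2_fin (d : ℕ) : (d : ℝ) ^ 2 / 2 ≤ Fintype.card (Sym2 (Fin d)) := by
  rw [Sym2.card, Fintype.card_fin, Nat.cast_choose_two]
  push_cast
  linarith [d.cast_nonneg (α := ℝ)]

lemma exists_covariance_packing (hd : 0 < d) {ρ : ℝ} (hρ : ρ ≠ 0) :
    ∃ C : Finset (Matrix (Fin d) (Fin d) ℝ),
      (∀ S ∈ C, S.IsHermitian ∧ frobeniusSq (S - 1) = ρ ^ 2) ∧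
      (C : Set (Matrix (Fin d) (Fin d) ℝ)).Pairwise
        (fun S T ↦ 3 / 4 * ρ ^ 2 ≤ frobeniusSq (S - T)) ∧
      (d : ℝ) ^ 2 / 72 ≤ Real.log C.card := by
  obtain ⟨A, hA, hlog⟩ := exists_binary_code_log_card_ge (Sym2 (Fin d))
  have hcard := sq_div_two_le_card_sym2_fin d
  have hsep : ∀ a ∈ A, ∀ b ∈ A, a ≠ b →
      3 / 4 * ρ ^ 2 ≤ frobeniusSq (perturbedIdentity ρ a - perturbedIdentity ρ b) := by
    intro a ha b hb hab
    calc 3 / 4 * ρ ^ 2 = 4 * (ρ / d) ^ 2 * (3 / 8 * ((d : ℝ) ^ 2 / 2)) := by field_simp; norm_num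
      _ ≤ 4 * (ρ / d) ^ 2 * hammingDist a b := by gcongr; linarith [hA ha hb hab]
      _ ≤ _ := mul_hammingDist_le_frobeniusSq_sub ρ a b
  have hinj : Set.InjOn (perturbedIdentity ρ) (A : Set (Sym2 (Fin d) → Bool)) := by
    intro a ha b hb heq
    by_contra hab
    have hzero := hsep a ha b hb hab
    have hpos : 0 < ρ ^ 2 := by positivity
    simp only [heq, sub_self, frobeniusSq, Matrix.zero_apply, ne_eq, OfNat.ofNat_ne_zero,
      not_false_eq_true, zero_pow, Finset.sum_const_zero] at hzero
    linarith
  classical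
  refine ⟨A.image (perturbedIdentity ρ), ?_, ?_, ?_⟩
  · simp only [Finset.mem_image, forall_exists_index, and_imp, forall_apply_eq_imp_iff₂]
    exact fun a _ ↦
      ⟨isHermitian_perturbedIdentity ρ a, frobeniusSq_perturbedIdentity_sub_one hd ρ a⟩
  · rw [Finset.coe_image]
    rintro _ ⟨a, ha, rfl⟩ _ ⟨b, hb, rfl⟩ hab
    exact hsep a ha b hb fun h ↦ hab (h ▸ rfl)
  · rw [Finset.card_image_of_injOn hinj]
    linarith

end Packing

section SampleSize

variable {d n : ℕ} {Y : Type*} [MeasurableSpace Y]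

lemma exists_isCoupling_multivariateGaussian_stdGaussian {ρ : ℝ} (hρ0 : 0 ≤ ρ) (hρ : ρ ≤ 1 / 2)
    {S : Matrix (Fin d) (Fin d) ℝ} (hS : S.IsHermitian) (hSρ : frobeniusSq (S - 1) ≤ ρ ^ 2) :
    ∃ γ, IsCoupling γ (multivariateGaussian 0 S) (stdGaussian (EuclideanSpace ℝ (Fin d))) ∧
      γ {z | z.1 ≠ z.2} ≤ ENNReal.ofReal (3 / 2 * ρ) := by
  obtain ⟨hac, hL2, hchi⟩ := chiSqDiv_multivariateGaussian_le hS (hSρ.trans (by nlinarith))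
  obtain ⟨γ, hγ, hmass⟩ := exists_isCoupling_le_sqrt_chiSqDiv hac hL2
  refine ⟨γ, hγ, hmass.trans (ENNReal.ofReal_le_ofReal ?_)⟩
  rw [Real.sqrt_le_left (by positivity)]
  nlinarith

lemma IsDP.log_card_covariances_le {ε ρ : ℝ} (hε : 0 < ε) (hρ0 : 0 ≤ ρ) (hρ : ρ ≤ 1 / 2)
    {M : Kernel (Fin n → EuclideanSpace ℝ (Fin d)) Y} [IsMarkovKernel M] (hM : IsDP M ε 0)
    {C : Finset (Matrix (Fin d) (Fin d) ℝ)}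
    (hC : ∀ S ∈ C, S.IsHermitian ∧ frobeniusSq (S - 1) ≤ ρ ^ 2)
    {U : Matrix (Fin d) (Fin d) ℝ → Set Y} (hU : ∀ S ∈ C, MeasurableSet (U S))
    (hdisj : (C : Set (Matrix (Fin d) (Fin d) ℝ)).PairwiseDisjoint U)
    (hsuccess : ∀ S ∈ C, 2 / 3 ≤ (M ∘ₘ gaussianSamples n S).real (U S)) :
    Real.log C.card ≤ 144 * (n * ρ * ε) := by
  have hlog := hM.log_card_le hε hU hdisj (p := 3 / 2 * ρ) (by positivity)
    (fun S hS ↦ exists_isCoupling_multivariateGaussian_stdGaussian hρ0 hρ (hC S hS).1 (hC S hS).2)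
    hsuccess
  linarith

end SampleSize

section Learning

variable {κ Ω : Type*} [MeasurableSpace Ω]

lemma measurable_real_probabilityMeasure {A : Set Ω} (hA : MeasurableSet A) :
    Measurable fun Q : ProbabilityMeasure Ω ↦ (Q : Measure Ω).real A :=
  ((Measure.measurable_coe hA).comp measurable_subtype_coe).ennreal_toReal

lemma exists_measurableSet_lt_abs_of_lt_tvDist {P Q : Measure Ω} {t : ℝ} (ht : t < tvDist P Q) :
    ∃ A, MeasurableSet A ∧ t < |P.real A - Q.real A| := by
  have : Nonempty {A : Set Ω // MeasurableSet A} := ⟨⟨∅, .empty⟩⟩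
  obtain ⟨A, hA⟩ := exists_lt_of_lt_ciSup ht
  exact ⟨A.1, A.2, hA⟩

/-- Total variation balls need not be measurable, so each is enlarged to the set of measures which
are `α`-close on the countably many events distinguishing two members of the family. -/
lemma exists_pairwiseDisjoint_measurableSet_of_lt_tvDist {C : Set κ} (hC : C.Countable)
    (P : κ → Measure Ω) [∀ a, IsProbabilityMeasure (P a)] {α : ℝ}
    (hsep : C.Pairwise fun a b ↦ 2 * α < tvDist (P a) (P b)) :
    ∃ U : κ → Set (ProbabilityMeasure Ω), (∀ a, MeasurableSet (U a)) ∧ C.PairwiseDisjoint U ∧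
      ∀ a, {Q : ProbabilityMeasure Ω | tvDist (P a) Q ≤ α} ⊆ U a := by
  have hevent (a b : κ) : ∃ A, MeasurableSet A ∧
      (2 * α < tvDist (P a) (P b) → 2 * α < |(P a).real A - (P b).real A|) := by
    by_cases hab : 2 * α < tvDist (P a) (P b)
    · obtain ⟨A, hA, hlt⟩ := exists_measurableSet_lt_abs_of_lt_tvDist hab
      exact ⟨A, hA, fun _ ↦ hlt⟩
    · exact ⟨∅, .empty, fun h ↦ absurd h hab⟩
  choose A hA hlt using hevent
  refine ⟨fun a ↦ ⋂ b ∈ C, ⋂ c ∈ C,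
    {Q | |(P a).real (A b c) - (Q : Measure Ω).real (A b c)| ≤ α}, fun a ↦ ?_, ?_, ?_⟩
  · refine .biInter hC fun b _ ↦ .biInter hC fun c _ ↦ measurableSet_le ?_ measurable_const
    exact (measurable_const.sub (measurable_real_probabilityMeasure (hA b c))).abs
  · intro a ha b hb hab
    refine Set.disjoint_left.2 fun Q hQa hQb ↦ (hlt a b (hsep ha hb hab)).not_ge ?_
    simp only [Set.mem_iInter, Set.mem_ofPred_eq] at hQa hQb
    have hPQ := hQa a ha b hb
    have hQP := hQb a ha b hb
    rw [abs_sub_comm] at hQP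
    linarith [abs_sub_le ((P a).real (A a b)) ((Q : Measure Ω).real (A a b)) ((P b).real (A a b))]
  · intro a Q hQ
    simp only [Set.mem_iInter, Set.mem_ofPred_eq]
    exact fun b _ c _ ↦ (abs_real_sub_real_le_tvDist (hA b c)).trans hQ

instance isProbabilityMeasure_gaussianSamples (n : ℕ) {d : ℕ} (S : Matrix (Fin d) (Fin d) ℝ) :
    IsProbabilityMeasure (gaussianSamples n S) :=
  inferInstanceAs (IsProbabilityMeasure (Measure.pi _))

variable {d n : ℕ} {ε α : ℝ}

lemma LearnsGaussian.two_thirds_le_real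
    {M : Kernel (Fin n → EuclideanSpace ℝ (Fin d)) (ProbabilityMeasure (EuclideanSpace ℝ (Fin d)))}
    [IsMarkovKernel M] (hM : LearnsGaussian M α) {S : Matrix (Fin d) (Fin d) ℝ}
    (hS : WellConditioned S) {U : Set (ProbabilityMeasure (EuclideanSpace ℝ (Fin d)))}
    (hU : {Q : ProbabilityMeasure (EuclideanSpace ℝ (Fin d)) |
      tvDist (multivariateGaussian 0 S) Q ≤ α} ⊆ U) :
    2 / 3 ≤ (M ∘ₘ gaussianSamples n S).real U := by
  have h := ENNReal.toReal_mono (by finiteness) ((hM S hS).trans (measure_mono hU))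
  simpa [ENNReal.toReal_div, measureReal_def] using h

/-- The packing radius `125 α` makes the packed Gaussians more than `2 α` apart in total
variation. -/
lemma LearnsGaussian.sample_size_ge (hd : 0 < d) (hε : 0 < ε) (hα : 0 < α) (hα' : α ≤ 1 / 250)
    {M : Kernel (Fin n → EuclideanSpace ℝ (Fin d)) (ProbabilityMeasure (EuclideanSpace ℝ (Fin d)))}
    [IsMarkovKernel M] (hDP : IsDP M ε 0) (hM : LearnsGaussian M α) :
    1 / 1296000 * ((d : ℝ) ^ 2 / (α * ε)) ≤ n := by
  obtain ⟨C, hC, hsep, hcard⟩ := exists_covariance_packing hd (ρ := 125 * α) (by positivity)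
  have htv : (C : Set (Matrix (Fin d) (Fin d) ℝ)).Pairwise fun S T ↦
      2 * α < tvDist (multivariateGaussian 0 S) (multivariateGaussian 0 T) := by
    intro S hS T hT hne
    have := div_le_tvDist_multivariateGaussian (ρ := 125 * α) (by positivity) (by linarith)
      (hC S hS).1 (hC T hT).1 (hC S hS).2.le (hC T hT).2.le (hsep hS hT hne)
    linarith
  obtain ⟨U, hU, hdisj, hball⟩ :=
    exists_pairwiseDisjoint_measurableSet_of_lt_tvDist C.countable_toSet _ htv
  have hwell (S) (hS : S ∈ C) : WellConditioned S :=
    wellConditioned_of_frobeniusSq_sub_one_le (hC S hS).1 ((hC S hS).2.trans_le (by nlinarith))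
  have hlog := hDP.log_card_covariances_le hε (ρ := 125 * α) (by positivity) (by linarith)
    (fun S hS ↦ ⟨(hC S hS).1, (hC S hS).2.le⟩) (fun S _ ↦ hU S) hdisj
    fun S hS ↦ hM.two_thirds_le_real (hwell S hS) (hball S)
  rw [← mul_div_assoc, div_le_iff₀ (by positivity)]
  linarith

end Learning

section Estimation

variable {d n : ℕ} {ε α : ℝ}

lemma frobeniusSq_sub_le (A B D : Matrix (Fin d) (Fin d) ℝ) :
    frobeniusSq (B - D) ≤ 2 * frobeniusSq (A - B) + 2 * frobeniusSq (A - D) := by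
  simp only [frobeniusSq, Finset.mul_sum, ← Finset.sum_add_distrib, Matrix.sub_apply]
  refine Finset.sum_le_sum fun i _ ↦ Finset.sum_le_sum fun j _ ↦ ?_
  nlinarith [sq_nonneg (A i j - B i j + (A i j - D i j))]

lemma measurable_frobeniusSq_sub (S : Matrix (Fin d) (Fin d) ℝ) :
    Measurable fun A : PSDMatrix d ↦ frobeniusSq (A.1 - S) := by
  have hentries : Measurable fun (A : PSDMatrix d) (i j : Fin d) ↦ A.1 i j := comap_measurable _
  have hentry (i j : Fin d) : Measurable fun A : PSDMatrix d ↦ A.1 i j :=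
    (measurable_pi_apply j).comp ((measurable_pi_apply i).comp hentries)
  exact Finset.measurable_sum _ fun i _ ↦ Finset.measurable_sum _ fun j _ ↦
    ((hentry i j).sub_const _).pow_const 2

lemma EstimatesCovariance.two_thirds_le_real {r : ℝ} (hr : 0 < r)
    {M : Kernel (Fin n → EuclideanSpace ℝ (Fin d)) (PSDMatrix d)} [IsMarkovKernel M]
    (hM : EstimatesCovariance M r) {S : Matrix (Fin d) (Fin d) ℝ} (hS : WellConditioned S) :
    2 / 3 ≤ (M ∘ₘ gaussianSamples n S).real {A | frobeniusSq (A.1 - S) < 3 * r} := by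
  set ν := M ∘ₘ gaussianSamples n S
  have hmeas := measurable_frobeniusSq_sub S
  have hmarkov : ν {A | 3 * r ≤ frobeniusSq (A.1 - S)} ≤ ENNReal.ofReal (1 / 3) := by
    calc ν {A | 3 * r ≤ frobeniusSq (A.1 - S)}
        ≤ ν {A | ENNReal.ofReal (3 * r) ≤ ENNReal.ofReal (frobeniusSq (A.1 - S))} :=
          measure_mono fun A hA ↦ ENNReal.ofReal_le_ofReal hA
      _ ≤ (∫⁻ A, ENNReal.ofReal (frobeniusSq (A.1 - S)) ∂ν) / ENNReal.ofReal (3 * r) :=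
          meas_ge_le_lintegral_div hmeas.ennreal_ofReal.aemeasurable (by simpa using hr)
            (by finiteness)
      _ ≤ ENNReal.ofReal r / ENNReal.ofReal (3 * r) := by gcongr; exact hM S hS
      _ = ENNReal.ofReal (1 / 3) := by
          rw [← ENNReal.ofReal_div_of_pos (by positivity)]
          congr 1
          field_simp
  have hfail : ν.real {A | frobeniusSq (A.1 - S) < 3 * r}ᶜ ≤ 1 / 3 :=
    ENNReal.toReal_le_of_le_ofReal (by norm_num) (by simpa [Set.compl_ofPred] using hmarkov)
  linarith [probReal_add_probReal_compl (μ := ν) (measurableSet_lt hmeas measurable_const :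
    MeasurableSet {A : PSDMatrix d | frobeniusSq (A.1 - S) < 3 * r})]

/-- At packing radius `ρ = α / 2` the separation `3 / 4 * ρ ^ 2` is four times the squared error
`3 * (α ^ 2 / 64)` exceeded with probability at most `1 / 3`. -/
lemma EstimatesCovariance.sample_size_ge (hd : 0 < d) (hε : 0 < ε) (hα : 0 < α) (hα' : α ≤ 1)
    {M : Kernel (Fin n → EuclideanSpace ℝ (Fin d)) (PSDMatrix d)} [IsMarkovKernel M]
    (hDP : IsDP M ε 0) (hM : EstimatesCovariance M (α ^ 2 / 64)) :
    1 / 5184 * ((d : ℝ) ^ 2 / (α * ε)) ≤ n := by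
  obtain ⟨C, hC, hsep, hcard⟩ := exists_covariance_packing hd (ρ := α / 2) (by positivity)
  have hdisj : (C : Set (Matrix (Fin d) (Fin d) ℝ)).PairwiseDisjoint fun S ↦
      {A : PSDMatrix d | frobeniusSq (A.1 - S) < 3 * (α ^ 2 / 64)} := by
    intro S hS T hT hne
    refine Set.disjoint_left.2 fun A hAS hAT ↦ ?_
    rw [Set.mem_ofPred_eq] at hAS hAT
    linarith [frobeniusSq_sub_le A.1 S T, hsep hS hT hne]
  have hwell (S) (hS : S ∈ C) : WellConditioned S :=
    wellConditioned_of_frobeniusSq_sub_one_le (hC S hS).1 ((hC S hS).2.trans_le (by nlinarith))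
  have hlog := hDP.log_card_covariances_le hε (ρ := α / 2) (by positivity) (by linarith)
    (fun S hS ↦ ⟨(hC S hS).1, (hC S hS).2.le⟩)
    (fun S _ ↦ measurableSet_lt (measurable_frobeniusSq_sub S) measurable_const) hdisj
    fun S hS ↦ hM.two_thirds_le_real (by positivity) (hwell S hS)
  rw [← mul_div_assoc, div_le_iff₀ (by positivity)]
  linarith

end Estimation

end PrivateCovariance

open PrivateCovariance in
theorem mainTheorem9 :
    (∃ α₀ : ℝ, 0 < α₀ ∧ α₀ ≤ 1 ∧ ∃ c : ℝ, 0 < c ∧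
      ∀ (d n : ℕ) (ε α : ℝ), 0 < ε → 0 < α → α ≤ α₀ →
      ∀ M : Kernel (Fin n → EuclideanSpace ℝ (Fin d))
          (ProbabilityMeasure (EuclideanSpace ℝ (Fin d))),
        IsMarkovKernel M → IsDP M ε 0 → LearnsGaussian M α →
          c * ((d : ℝ) ^ 2 / (α * ε)) ≤ (n : ℝ)) ∧
    (∃ c : ℝ, 0 < c ∧
      ∀ (d n : ℕ) (ε α : ℝ), 0 < ε → 0 < α → α ≤ 1 →
      ∀ M : Kernel (Fin n → EuclideanSpace ℝ (Fin d)) (PSDMatrix d),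
        IsMarkovKernel M → IsDP M ε 0 → EstimatesCovariance M (α ^ 2 / 64) →
          c * ((d : ℝ) ^ 2 / (α * ε)) ≤ (n : ℝ)) := by
  refine ⟨⟨1 / 250, by norm_num, by norm_num, 1 / 1296000, by norm_num, ?_⟩,
    1 / 5184, by norm_num, ?_⟩
  · intro d n ε α hε hα hα' M _ hDP hM
    rcases d.eq_zero_or_pos with rfl | hd
    · simp
    · exact hM.sample_size_ge hd hε hα hα' hDP
  · intro d n ε α hε hα hα' M _ hDP hM
    rcases d.eq_zero_or_pos with rfl | hd
    · simp
    · exact hM.sample_size_ge hd hε hα hα' hDP
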